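/- Let $\Delta\subset\mathbb R^4$ be the root system $F_4$, consisting of the vectors $\pm e_i\pm e_j$ ($i\ne j$), $\pm e_i$ and $\frac12(\pm e_1\pm e_2\pm e_3\pm e_4)$, and let $G$ be its Weyl group, i.e. the group generated by the orthogonal reflections in the hyperplanes orthogonal to the roots. A reflection subgroup of $G$ is a subgroup generated by reflections in hyperplanes; its type is the Coxeter diagram of its fundamental chamber (root lengths are disregarded, and $2X$ denotes the disjoint union of two copies of the diagram $X$); its rank is the dimension of the span of the normals of its mirrors. A reflection subgroup $H\ne G$ is maximal if no reflection subgroup $K$ of $G$ satisfies $H\subsetneq K\subsetneq G$. A closed root subsystem of $\Delta$ is a root system $\Delta_1\subset\Delta$ (a subset stable under the reflections in its own elements) such that $\alpha,\beta\in\Delta_1$ and $\alpha+\beta\in\Delta$ imply $\alpha+\beta\in\Delta_1$. (1) A reflection subgroup of $G$ is maximal if and only if it is of type $B_4$ or of type $2A_2$, and both types occur. (2) There is a reflection subgroup of $G$ of rank $4$ and of type $2B_2$, and $2B_2$ is the unique type of rank $4$ reflection subgroups that is not the type of the Weyl group of a closed root subsystem: a reflection subgroup $H$ of $G$ of rank $4$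 is of type $2B_2$ if and only if there is no closed root subsystem $\Delta_1$ of $\Delta$ whose Weyl group has the same type as $H$. -/

import Mathlib

namespace ReflectionSubgroup

noncomputable section

/-- Disjoint union of two Coxeter diagrams: nodes of different components are not joined
(entry `2`). For `M = M'` this is the diagram of type `2M`. -/
def disjointUnion {B B' : Type*} (M : CoxeterMatrix B) (M' : CoxeterMatrix B') :
    CoxeterMatrix (B ⊕ B') where
  M := Matrix.fromBlocks M.M (Matrix.of fun _ _ => 2) (Matrix.of fun _ _ => 2) M'.M
  isSymm := Matrix.IsSymm.fromBlocks M.isSymm (by ext; rfl) M'.isSymm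
  diagonal := by
    rintro (i | i)
    · exact M.diagonal i
    · exact M'.diagonal i
  off_diagonal := by
    rintro (i | i) (j | j) h
    · exact M.off_diagonal i j (fun e => h (congrArg Sum.inl e))
    · simp
    · simp
    · exact M'.off_diagonal i j (fun e => h (congrArg Sum.inr e))

section Euclidean

variable {E : Type*} [NormedAddCommGroup E] [InnerProductSpace ℝ E]

/-- The orthogonal reflection in the hyperplane orthogonal to `v` (for `v ≠ 0`). -/
def reflIn (v : E) : E ≃ₗᵢ[ℝ] E :=
  (ℝ ∙ v)ᗮ.reflection

/-- `g` is a reflection in some hyperplane through the origin. -/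
def IsReflection (g : E ≃ₗᵢ[ℝ] E) : Prop :=
  ∃ v : E, v ≠ 0 ∧ g = reflIn v

/-- `H` is a reflection subgroup of `G`: a subgroup generated by reflections. -/
def IsReflectionSubgroup (G H : Subgroup (E ≃ₗᵢ[ℝ] E)) : Prop :=
  H ≤ G ∧ ∃ S : Set (E ≃ₗᵢ[ℝ] E), (∀ g ∈ S, IsReflection g) ∧ Subgroup.closure S = H

/-- `H` is a maximal reflection subgroup of `G`: it is maximal, with respect to inclusion, among
the reflection subgroups of `G` different from `G`. -/
def IsMaximalReflectionSubgroup (G H : Subgroup (E ≃ₗᵢ[ℝ] E)) : Prop :=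
  Maximal (fun K => IsReflectionSubgroup G K ∧ K ≠ G) H

/-- The rank of a reflection group: the dimension of the span of the normals of its mirrors. -/
def rank (H : Subgroup (E ≃ₗᵢ[ℝ] E)) : ℕ :=
  Module.finrank ℝ (Submodule.span ℝ {v : E | v ≠ 0 ∧ reflIn v ∈ H})

/-- The group `H` has Coxeter diagram `M`: it is generated by the reflections in the facets of a
simplicial cone whose outward unit normals `a i` are linearly independent, the facets `i ≠ j`
forming the dihedral angle `π / M i j`. -/
def HasType {B : Type*} (H : Subgroup (E ≃ₗᵢ[ℝ] E)) (M : CoxeterMatrix B) : Prop :=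
  ∃ a : B → E, LinearIndependent ℝ a ∧
    (∀ i j, inner ℝ (a i) (a j) = -Real.cos (Real.pi / (M i j : ℝ))) ∧
    Subgroup.closure (Set.range fun i => reflIn (a i)) = H

/-- `H` and `K` are of the same type: they have a common Coxeter diagram. -/
def SameType (H K : Subgroup (E ≃ₗᵢ[ℝ] E)) : Prop :=
  ∃ (n : ℕ) (M : CoxeterMatrix (Fin n)), HasType H M ∧ HasType K M

/-- The Weyl group of a set of roots: the group generated by the reflections in the roots. -/
def weylGroup (Δ : Set E) : Subgroup (E ≃ₗᵢ[ℝ] E) :=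
  Subgroup.closure (reflIn '' Δ)

/-- `Δ₁` is a closed root subsystem of the root system `Δ`: it is a root system contained in `Δ`
(i.e. a subset stable under the reflections in its own elements), and a sum of two of its elements
that lies in `Δ` lies in `Δ₁`. -/
structure IsClosedRootSubsystem (Δ Δ₁ : Set E) : Prop where
  subset : Δ₁ ⊆ Δ
  refl_mem : ∀ α ∈ Δ₁, ∀ β ∈ Δ₁, reflIn α β ∈ Δ₁
  add_mem : ∀ α ∈ Δ₁, ∀ β ∈ Δ₁, α + β ∈ Δ → α + β ∈ Δ₁

end Euclidean

/-- The root system `F₄` in `ℝ⁴`: the 24 long roots `± eᵢ ± eⱼ` (`i ≠ j`), and the 24 short roots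
`± eᵢ` and `(± e₁ ± e₂ ± e₃ ± e₄) / 2`. -/
def rootsF4 : Set (EuclideanSpace ℝ (Fin 4)) :=
  {v | ∃ i j : Fin 4, i ≠ j ∧ ∃ s t : ℝ, (s = 1 ∨ s = -1) ∧ (t = 1 ∨ t = -1) ∧
      v = EuclideanSpace.single i s + EuclideanSpace.single j t} ∪
  {v | ∃ i : Fin 4, ∃ s : ℝ, (s = 1 ∨ s = -1) ∧ v = EuclideanSpace.single i s} ∪
  {v | ∀ i : Fin 4, v i = 1 / 2 ∨ v i = -1 / 2}

/-- The Weyl group of the root system `F₄`. -/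
def weylF4 : Subgroup (EuclideanSpace ℝ (Fin 4) ≃ₗᵢ[ℝ] EuclideanSpace ℝ (Fin 4)) :=
  weylGroup rootsF4

end

end ReflectionSubgroup

/-! ### Reflections in a Euclidean space, and invariance of types under isometries. -/

namespace ReflectionSubgroup

section Euclidean

variable {E : Type*} [NormedAddCommGroup E] [InnerProductSpace ℝ E]

/-! A reflection subgroup of $G$ is the same thing as a set of mirrors stable under its own
reflections. For the nontrivial direction, the product of the linear forms of a stable set is
multiplied by $\det g$ under each $g$ of the group generated. A reflection of that group with a
foreign mirror would fix a point off all the given mirrors while changing the sign of the form,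
which is impossible (`exists_mem_span_of_reflIn_mem`).

Inside a stable set, keep the roots whose reflection is not generated by earlier ones, for the order
given by a positive linear functional on normalized roots. These are pairwise non-acute, hence
linearly independent, hence at most four, and they generate the same group (`simples`,
`angle_le_four_of_mem_simples`). So every question concerns increasing quadruples of non-acute
positive roots, a finite check on 24 roots.

Maximality: the check `exists_maximal_testBit` puts each proper reflection subgroup inside a listed
group of type $B_4$ or $2A_2$. Neither type embeds in the other (`no_2A2_in_B4`, `no_B2_in_2A2`).
Groups of the same type are conjugate under an isometry, hence of the same finite order, so an
inclusion between them is an equality.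

Closed subsystems: by `hasListedAngles`, a group of rank 4 has the diagram of $2B_2$ or of one of
eight explicit closed subsystems. Conversely, each factor of a $2B_2$ contains a short root. The sum
of these two orthogonal short roots is a long root, and its reflection mixes the two factors, so
closedness is contradictory (`IsClosedRootSubsystem.not_hasType`). -/

theorem reflIn_apply (v x : E) : reflIn v x = x - (2 * inner ℝ v x / ‖v‖ ^ 2) • v := by
  rw [reflIn, Submodule.reflection_orthogonal_apply, Submodule.reflection_singleton_apply]
  simp only [RCLike.ofReal_real_eq_id, id]
  rw [neg_sub, two_nsmul, ← add_smul]
  congr 2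
  ring

theorem reflIn_self (v : E) : reflIn v v = -v :=
  Submodule.reflection_orthogonalComplement_singleton_eq_neg v

theorem reflIn_smul {c : ℝ} (hc : c ≠ 0) (v : E) : reflIn (c • v) = reflIn v := by
  have h : (ℝ ∙ (c • v)) = ℝ ∙ v := Submodule.span_singleton_smul_eq (IsUnit.mk0 c hc) v
  ext x
  simp only [reflIn, h]

theorem reflIn_neg (v : E) : reflIn (-v) = reflIn v := by
  simpa using reflIn_smul (c := -1) (by norm_num) v

theorem reflIn_mul_self (v : E) : reflIn v * reflIn v = 1 :=
  Submodule.reflection_mul_reflection _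

theorem reflIn_inv (v : E) : (reflIn v)⁻¹ = reflIn v :=
  inv_eq_of_mul_eq_one_left (reflIn_mul_self v)

theorem reflIn_eq_self_of_inner_eq_zero {v x : E} (h : inner ℝ v x = 0) : reflIn v x = x := by
  simp [reflIn_apply, h]

theorem inner_eq_zero_of_reflIn_eq_self {v x : E} (hv : v ≠ 0) (h : reflIn v x = x) :
    inner ℝ v x = 0 := by
  rw [reflIn_apply, sub_eq_self, smul_eq_zero] at h
  have := norm_ne_zero_iff.2 hv
  have h2 := h.resolve_right hv
  field_simp at h2
  linarith

theorem mul_reflIn_mul_inv (g : E ≃ₗᵢ[ℝ] E) (v : E) : g * reflIn v * g⁻¹ = reflIn (g v) := by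
  ext x
  have hx : g (g⁻¹ x) = x := g.apply_symm_apply x
  have : inner ℝ v (g⁻¹ x) = inner ℝ (g v) x := by
    conv_rhs => rw [← hx]
    exact (g.inner_map_map _ _).symm
  change g (reflIn v (g⁻¹ x)) = _
  rw [reflIn_apply, reflIn_apply, map_sub, map_smul, hx, this, g.norm_map]

theorem reflIn_eq_of_mem_span {v w : E} (hv : v ≠ 0) (h : v ∈ ℝ ∙ w) : reflIn v = reflIn w := by
  obtain ⟨c, rfl⟩ := Submodule.mem_span_singleton.1 h
  exact reflIn_smul (fun hc => hv (by simp [hc])) w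

theorem inner_reflIn_left (v x y : E) : inner ℝ (reflIn v x) y = inner ℝ x (reflIn v y) := by
  conv_rhs => rw [← (reflIn v).inner_map_map]
  have : reflIn v (reflIn v y) = y := Submodule.reflection_reflection _ y
  rw [this]

theorem closure_apply_eq_self {T : Set E} {g : E ≃ₗᵢ[ℝ] E}
    (hg : g ∈ Subgroup.closure (reflIn '' T)) {x : E} (hx : ∀ t ∈ T, inner ℝ t x = 0) :
    g x = x := by
  induction hg using Subgroup.closure_induction with
  | mem g hg =>
    obtain ⟨t, ht, rfl⟩ := hg
    exact reflIn_eq_self_of_inner_eq_zero (hx t ht)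
  | one => rfl
  | mul g h _ _ h1 h2 => change g (h x) = x; rw [h2, h1]
  | inv g _ h1 => exact (g.symm_apply_eq).2 h1.symm

/-- The group fixes the orthogonal complement of `T` pointwise, so `v` is orthogonal to that
complement. -/
theorem mem_span_of_reflIn_mem_closure [FiniteDimensional ℝ E] {T : Set E} {v : E} (hv : v ≠ 0)
    (h : reflIn v ∈ Subgroup.closure (reflIn '' T)) : v ∈ Submodule.span ℝ T := by
  rw [← Submodule.orthogonal_orthogonal (Submodule.span ℝ T), Submodule.mem_orthogonal]
  intro x hx
  rw [real_inner_comm]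
  refine inner_eq_zero_of_reflIn_eq_self hv (closure_apply_eq_self h fun t ht => ?_)
  exact (Submodule.mem_orthogonal _ _).1 hx t (Submodule.subset_span ht)

theorem det_reflIn [FiniteDimensional ℝ E] {v : E} (hv : v ≠ 0) :
    LinearMap.det ((reflIn v).toLinearEquiv : E →ₗ[ℝ] E) = -1 := by
  have := Submodule.det_reflection (𝕜 := ℝ) (ℝ ∙ v)ᗮ
  rw [Submodule.orthogonal_orthogonal, finrank_span_singleton hv, pow_one] at this
  exact this

theorem closure_range_map_conj {B : Type*} (g : E ≃ₗᵢ[ℝ] E) (a : B → E) :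
    (Subgroup.closure (Set.range fun i => reflIn (a i))).map (MulAut.conj g).toMonoidHom =
      Subgroup.closure (Set.range fun i => reflIn (g (a i))) := by
  rw [MonoidHom.map_closure, ← Set.range_comp]
  congr 2
  ext1 i
  exact mul_reflIn_mul_inv g (a i)

/-- Two groups with the same Coxeter diagram are conjugate under an isometry. -/
theorem HasType.exists_conj [FiniteDimensional ℝ E] {B : Type*} {H K : Subgroup (E ≃ₗᵢ[ℝ] E)}
    {M : CoxeterMatrix B} (hH : HasType H M) (hK : HasType K M) :
    ∃ g : E ≃ₗᵢ[ℝ] E, K = H.map (MulAut.conj g).toMonoidHom := by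
  obtain ⟨a, ha, hai, rfl⟩ := hH
  obtain ⟨b, hb, hbi, rfl⟩ := hK
  let f : Submodule.span ℝ (Set.range a) →ₗ[ℝ] E := (Module.Basis.span ha).constr ℝ b
  have hf : ∀ i, f (Module.Basis.span ha i) = b i := fun i => Module.Basis.constr_basis _ _ _ _
  have hcoe : ∀ i, (Module.Basis.span ha i : E) = a i := fun i => by rw [Module.Basis.span_apply]
  -- The diagram fixes the Gram matrix of the normals, so matching normals preserves inner products
  -- on their span.
  have hf' : ∀ x y, inner ℝ (f x) (f y) = inner ℝ x y := by
    have : (innerₗ E).compl₁₂ f f = innerₗ (Submodule.span ℝ (Set.range a)) := by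
      refine LinearMap.BilinForm.ext_basis (Module.Basis.span ha) fun i j => ?_
      rw [LinearMap.compl₁₂_apply, innerₗ_apply_apply, innerₗ_apply_apply, hf, hf, hbi,
        Submodule.coe_inner, hcoe, hcoe, hai]
    intro x y
    exact LinearMap.congr_fun (LinearMap.congr_fun this x) y
  let L : E →ₗᵢ[ℝ] E := (f.isometryOfInner hf').extend
  refine ⟨L.toLinearIsometryEquiv rfl, ?_⟩
  rw [closure_range_map_conj]
  congr 2
  ext1 i
  have : L (a i) = b i := by
    have := (f.isometryOfInner hf').extend_apply (Module.Basis.span ha i)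
    rw [hcoe] at this
    exact this.trans (hf i)
  simp [this]

theorem HasType.map_conj {B : Type*} {H : Subgroup (E ≃ₗᵢ[ℝ] E)} {M : CoxeterMatrix B}
    (hH : HasType H M) (g : E ≃ₗᵢ[ℝ] E) : HasType (H.map (MulAut.conj g).toMonoidHom) M := by
  obtain ⟨a, ha, hai, rfl⟩ := hH
  exact ⟨fun i => g (a i), ha.map' g.toLinearEquiv.toLinearMap (LinearEquiv.ker _),
    fun i j => (g.inner_map_map _ _).trans (hai i j), (closure_range_map_conj g a).symm⟩

theorem HasType.card_eq [FiniteDimensional ℝ E] {B : Type*} {H K : Subgroup (E ≃ₗᵢ[ℝ] E)}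
    {M : CoxeterMatrix B} (hH : HasType H M) (hK : HasType K M) : Nat.card H = Nat.card K := by
  obtain ⟨g, rfl⟩ := hH.exists_conj hK
  exact Nat.card_congr (H.equivMapOfInjective _ (MulAut.conj g).injective).toEquiv

/-- The common diagram makes the groups conjugate under an isometry, which carries any other diagram
of `H` to `K`. -/
theorem HasType.of_sameType [FiniteDimensional ℝ E] {B : Type*} {H K : Subgroup (E ≃ₗᵢ[ℝ] E)}
    {M : CoxeterMatrix B} (hH : HasType H M) (h : SameType H K) : HasType K M := by
  obtain ⟨n, N, h1, h2⟩ := h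
  obtain ⟨g, rfl⟩ := h1.exists_conj h2
  exact hH.map_conj g

end Euclidean

end ReflectionSubgroup

/-! ### Integer tables for the positive roots, their angles and their reflections. -/

namespace ReflectionSubgroup

/-- The positive roots of `F₄`, multiplied by `2`, ordered by the values of a linear functional
on the normalized roots; the first four are the simple roots. -/
def rootZ : Fin 24 → Fin 4 → ℤ :=
  ![![0, 0, 0, 2], ![0, 0, 2, -2], ![0, 2, -2, 0], ![1, -1, -1, -1],
    ![1, -1, -1, 1], ![0, 2, 0, -2], ![0, 0, 2, 0], ![0, 0, 2, 2],
    ![0, 2, 0, 2], ![1, -1, 1, -1], ![2, -2, 0, 0], ![0, 2, 0, 0],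
    ![1, -1, 1, 1], ![0, 2, 2, 0], ![1, 1, -1, -1], ![2, 0, -2, 0],
    ![1, 1, -1, 1], ![2, 0, 0, -2], ![2, 0, 0, 2], ![1, 1, 1, -1],
    ![1, 1, 1, 1], ![2, 0, 2, 0], ![2, 0, 0, 0], ![2, 2, 0, 0]]

/-- The inner products of the vectors `rootZ i`. -/
def gramZ (i j : Fin 24) : ℤ :=
  rootZ i 0 * rootZ j 0 + rootZ i 1 * rootZ j 1 + rootZ i 2 * rootZ j 2 + rootZ i 3 * rootZ j 3

/-- The angles of the positive roots, as hexadecimal digits. -/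
def angleTable : ℕ :=
  0x165665565652622522522522616556656525265222255222561665522256256256222352656156252265522665223225656512622562525225632263565621265226252552362236565262125622256332526254652526216522523623252645562225561632252234266532652252656123522243625623525662223212632556544252256526222321365265452425622552252563143622633622265225525236416322366322256252632225361425225463522625362252634152224536225625323456222516324326226552234365225261233462522263522654632232142554252236256245362223415245252322626542365443251223523222265624634534522132225263543252226326542314222536452325223662453241

/-- The angle of two positive roots: the values `1`, ..., `6` encode the angles
`0`, `π / 2`, `2π / 3`, `3π / 4`, `π / 3`, `π / 4`. -/
def angle (i j : Fin 24) : ℕ :=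
  (angleTable >>> (4 * (24 * i.val + j.val))) % 16

/-- The images of the positive roots under the reflections, as pairs of hexadecimal digits. -/
def imageTable : ℕ :=
  0x372b222e302528332d342f0c360a093107063204033501002a362f2324313229352c0d2e0b3730080706053334020100022635292c2127100f0e2a330b2d3408313605040317320027032834202d11260f0e322b2c0a093537300504160201332104250033122d100f26310c290a2b08072e351603023714052001241332112c270e0d300b28092a2f06173403021536080007142312311021290d0c0b252e1715062a0433022f16010915061322113028200d0c240a162f0714052b0332172e0d061514130701232f24170c0b2209081216052e302a1100070c151406122200252e0d16230a090817132f042b3101100f160a0403121110170e2d0c26150921252b271413022800170e050b130211100f160d2c142720082a241526031201290a16150c091211040f0322142b171325070628100e2d0100170b0d1413080510020e1523162a2412070611292c0f0100171008140b1202160f0e0d00132129150723050426112a0c11161509130a17030f0e010c201214282206050410270d2b1716110e130f1510121405030b0a090227200d040c08012617160f100e121114151302040b0a03082126050c090d2700121615140c170a100f040713001109080d06250e0321220b17131514160d110b050e120610010908070c0f2420020a231714151613120d10080b110c0e07060f0a09050023020104151617141312110c0a090d10060f0e07080b0104032205001716121410150f13110e080c0b0a040d0700020903052106171615131411120e0f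100d090b0a0c050106080304020720

/-- The positive root that is, up to sign, the image of the root `j` under the reflection in the
root `i`. -/
def image (i j : Fin 24) : Fin 24 :=
  Fin.ofNat 24 ((imageTable >>> (8 * (24 * i.val + j.val))) % 32)

/-- The sign of the image of the root `j` under the reflection in the root `i`. -/
def imageSign (i j : Fin 24) : ℤ :=
  bif imageTable.testBit (8 * (24 * i.val + j.val) + 5) then -1 else 1

theorem gramZ_self : ∀ i, gramZ i i = 4 ∨ gramZ i i = 8 := by
  decide +kernel

theorem angle_spec : ∀ i j, (angle i j = 1 ∧ i = j) ∨ (angle i j = 2 ∧ gramZ i j = 0) ∨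
    (angle i j = 3 ∧ gramZ i j < 0 ∧ 4 * gramZ i j ^ 2 = gramZ i i * gramZ j j) ∨
    (angle i j = 4 ∧ gramZ i j < 0 ∧ 2 * gramZ i j ^ 2 = gramZ i i * gramZ j j) ∨
    (angle i j = 5 ∧ 0 < gramZ i j ∧ 4 * gramZ i j ^ 2 = gramZ i i * gramZ j j) ∨
    (angle i j = 6 ∧ 0 < gramZ i j ∧ 2 * gramZ i j ^ 2 = gramZ i i * gramZ j j) := by
  decide +kernel

/-- The reflection formula with the denominator `gramZ i i` cleared; it certifies the image table
against the coordinates. -/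
theorem image_spec : ∀ i j k, gramZ i i * (imageSign i j * rootZ (image i j) k) =
    gramZ i i * rootZ j k - 2 * gramZ i j * rootZ i k := by
  decide +kernel

theorem imageSign_eq (i j : Fin 24) : imageSign i j = 1 ∨ imageSign i j = -1 := by
  unfold imageSign
  cases imageTable.testBit (8 * (24 * i.val + j.val) + 5) <;> simp

theorem image_image : ∀ i j, image i (image i j) = j := by
  decide +kernel

theorem image_self : ∀ i, image i i = i ∧ imageSign i i = -1 := by
  decide +kernel

theorem imageSign_image : ∀ i j, imageSign i (image i j) = imageSign i j := by
  decide +kernel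

theorem imageSign_eq_one : ∀ i j, image i j = j → i = j ∨ imageSign i j = 1 := by
  decide +kernel

/-- For unit vectors $u_i,u_j$ at an acute angle and a functional $f$ with $0<f(u_i)<f(u_j)$, the
reflected vector is $u_j-cu_i$ with $0<c\le\sqrt2$. Its value has absolute value below $f(u_j)$, so
the positive root on its line precedes $j$. This is why the roots are ordered by normalized values.
-/
theorem image_lt : ∀ i j, i < j → 4 < angle i j → image i j < j := by
  decide +kernel

theorem angle_comm : ∀ i j, angle i j = angle j i := by
  decide +kernel

theorem exists_functional_pos : ∃ c : Fin 4 → ℤ, ∀ i,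
    0 < c 0 * rootZ i 0 + c 1 * rootZ i 1 + c 2 * rootZ i 2 + c 3 * rootZ i 3 :=
  ⟨![8, 3, 2, 1], by decide +kernel⟩

end ReflectionSubgroup

/-! ### The positive roots as vectors, and their agreement with `rootsF4`. -/

namespace ReflectionSubgroup

noncomputable section

/-- The positive roots of `F₄`. -/
def root (i : Fin 24) : EuclideanSpace ℝ (Fin 4) :=
  WithLp.toLp 2 fun k => (rootZ i k : ℝ) / 2

theorem root_apply (i : Fin 24) (k : Fin 4) : root i k = (rootZ i k : ℝ) / 2 :=
  rfl

theorem inner_root (i j : Fin 24) : inner ℝ (root i) (root j) = (gramZ i j : ℝ) / 4 := by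
  simp only [PiLp.inner_apply, Fin.sum_univ_four, root_apply, gramZ, RCLike.inner_apply,
    conj_trivial]
  push_cast
  ring

theorem norm_root_sq (i : Fin 24) : ‖root i‖ ^ 2 = (gramZ i i : ℝ) / 4 := by
  rw [← real_inner_self_eq_norm_sq, inner_root]

theorem gramZ_self_pos (i : Fin 24) : (0 : ℝ) < gramZ i i := by
  rcases gramZ_self i with h | h <;> rw [h] <;> norm_num

theorem norm_root_pos (i : Fin 24) : 0 < ‖root i‖ := by
  have := norm_root_sq i
  have h2 := gramZ_self_pos i
  rw [norm_pos_iff]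
  intro h
  rw [h, norm_zero] at this
  linarith

theorem root_ne_zero (i : Fin 24) : root i ≠ 0 :=
  norm_pos_iff.1 (norm_root_pos i)

theorem reflIn_root (i j : Fin 24) :
    reflIn (root i) (root j) = (imageSign i j : ℝ) • root (image i j) := by
  have h := gramZ_self_pos i
  ext k
  have hk : (gramZ i i : ℝ) * (imageSign i j * rootZ (image i j) k) =
      gramZ i i * rootZ j k - 2 * gramZ i j * rootZ i k := by exact_mod_cast image_spec i j k
  rw [reflIn_apply, norm_root_sq, inner_root]
  simp only [PiLp.sub_apply, PiLp.smul_apply, root_apply, smul_eq_mul]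
  field_simp
  linarith

theorem cast_imageSign (i j : Fin 24) : (imageSign i j : ℝ) = 1 ∨ (imageSign i j : ℝ) = -1 := by
  rcases imageSign_eq i j with h | h <;> simp [h]

theorem reflIn_root_image (i j : Fin 24) :
    reflIn (root (image i j)) = reflIn (root i) * reflIn (root j) * reflIn (root i) := by
  have h := mul_reflIn_mul_inv (reflIn (root i)) (root j)
  rw [reflIn_inv, reflIn_root] at h
  rw [h]
  rcases cast_imageSign i j with h | h <;> simp [h, reflIn_neg]

theorem exists_root_eq_of_pair : ∀ i j : Fin 4, i ≠ j → ∀ s t : Bool, ∃ m : Fin 24,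
    (∀ k, rootZ m k = (if k = i then (bif s then 2 else -2) else 0) +
      (if k = j then (bif t then 2 else -2) else 0)) ∨
    (∀ k, -rootZ m k = (if k = i then (bif s then 2 else -2) else 0) +
      (if k = j then (bif t then 2 else -2) else 0)) := by
  decide +kernel

theorem exists_root_eq_of_single : ∀ i : Fin 4, ∃ m : Fin 24,
    ∀ k, rootZ m k = if k = i then 2 else 0 := by
  decide +kernel

theorem exists_root_eq_of_half : ∀ s : Fin 4 → Bool, ∃ m : Fin 24,
    (∀ k, rootZ m k = bif s k then 1 else -1) ∨ (∀ k, -rootZ m k = bif s k then 1 else -1) := by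
  decide +kernel

theorem rootZ_cases : ∀ m : Fin 24,
    (∃ i j : Fin 4, i ≠ j ∧ ∃ s t : Bool,
      ∀ k, rootZ m k = (if k = i then (bif s then 2 else -2) else 0) +
        (if k = j then (bif t then 2 else -2) else 0)) ∨
    (∃ i : Fin 4, ∀ k, rootZ m k = if k = i then 2 else 0) ∨
    (∀ k, rootZ m k = 1 ∨ rootZ m k = -1) := by
  decide +kernel

theorem neg_mem_rootsF4 {v : EuclideanSpace ℝ (Fin 4)} (hv : v ∈ rootsF4) : -v ∈ rootsF4 := by
  rcases hv with (⟨i, j, hij, s, t, hs, ht, rfl⟩ | ⟨i, s, hs, rfl⟩) | h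
  · refine Or.inl (Or.inl ⟨i, j, hij, -s, -t, ?_, ?_, ?_⟩)
    · rcases hs with rfl | rfl <;> simp
    · rcases ht with rfl | rfl <;> simp
    · ext k
      simp
      split_ifs <;> ring
  · refine Or.inl (Or.inr ⟨i, -s, ?_, ?_⟩)
    · rcases hs with rfl | rfl <;> simp
    · ext k
      simp
      split_ifs <;> ring
  · refine Or.inr fun i => ?_
    rw [PiLp.neg_apply]
    rcases h i with h | h <;> rw [h] <;> norm_num

theorem root_mem_rootsF4 (m : Fin 24) : root m ∈ rootsF4 := by
  rcases rootZ_cases m with ⟨i, j, hij, s, t, h⟩ | ⟨i, h⟩ | h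
  · refine Or.inl (Or.inl ⟨i, j, hij, bif s then 1 else -1, bif t then 1 else -1, ?_, ?_, ?_⟩)
    · cases s <;> simp
    · cases t <;> simp
    · ext k
      rw [root_apply, h]
      simp
      split_ifs <;> cases s <;> cases t <;> simp <;> norm_num
  · refine Or.inl (Or.inr ⟨i, 1, Or.inl rfl, ?_⟩)
    ext k
    rw [root_apply, h]
    simp
    split_ifs <;> simp
  · refine Or.inr fun k => ?_
    rw [root_apply]
    rcases h k with h | h <;> simp [h]

theorem exists_eq_root {v : EuclideanSpace ℝ (Fin 4)} (hv : v ∈ rootsF4) :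
    ∃ m, v = root m ∨ v = -root m := by
  have hsign : ∀ s : ℝ, s = 1 ∨ s = -1 → ∃ b : Bool, s = bif b then 1 else -1 := by
    rintro s (rfl | rfl)
    · exact ⟨true, rfl⟩
    · exact ⟨false, rfl⟩
  rcases hv with (⟨i, j, hij, s, t, hs, ht, rfl⟩ | ⟨i, s, hs, rfl⟩) | h
  · obtain ⟨s, rfl⟩ := hsign s hs
    obtain ⟨t, rfl⟩ := hsign t ht
    obtain ⟨m, h | h⟩ := exists_root_eq_of_pair i j hij s t
    · refine ⟨m, Or.inl ?_⟩
      ext k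
      rw [root_apply, h]
      simp
      split_ifs <;> cases s <;> cases t <;> simp <;> norm_num
    · refine ⟨m, Or.inr ?_⟩
      ext k
      rw [PiLp.neg_apply, root_apply, ← neg_div, ← Int.cast_neg, h]
      simp
      split_ifs <;> cases s <;> cases t <;> simp <;> norm_num
  · obtain ⟨m, h⟩ := exists_root_eq_of_single i
    refine ⟨m, ?_⟩
    rcases hs with rfl | rfl
    · left
      ext k
      rw [root_apply, h]
      simp
      split_ifs <;> simp
    · right
      ext k
      rw [PiLp.neg_apply, root_apply, h]
      simp
      split_ifs <;> simp
  · choose s hs using fun i => hsign (2 * v i) (by rcases h i with h | h <;> rw [h] <;> norm_num)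
    obtain ⟨m, h | h⟩ := exists_root_eq_of_half s
    · refine ⟨m, Or.inl ?_⟩
      ext k
      have := hs k
      rw [root_apply, h]
      cases hk : s k <;> simp [hk] at this ⊢ <;> linarith
    · refine ⟨m, Or.inr ?_⟩
      ext k
      have := hs k
      rw [PiLp.neg_apply, root_apply, ← neg_div, ← Int.cast_neg, h]
      cases hk : s k <;> simp [hk] at this ⊢ <;> linarith

/-! ### Groups generated by sets of mirrors, and the anti-invariant form. -/

/-- The group generated by the reflections in a set of positive roots. -/
def groupOf (S : Set (Fin 24)) :
    Subgroup (EuclideanSpace ℝ (Fin 4) ≃ₗᵢ[ℝ] EuclideanSpace ℝ (Fin 4)) :=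
  Subgroup.closure ((fun i => reflIn (root i)) '' S)

theorem groupOf_eq (S : Set (Fin 24)) : groupOf S = Subgroup.closure (reflIn '' (root '' S)) := by
  rw [groupOf, Set.image_image]

theorem reflIn_mem_groupOf {S : Set (Fin 24)} {i : Fin 24} (hi : i ∈ S) :
    reflIn (root i) ∈ groupOf S :=
  Subgroup.subset_closure ⟨i, hi, rfl⟩

theorem groupOf_le {S : Set (Fin 24)}
    {H : Subgroup (EuclideanSpace ℝ (Fin 4) ≃ₗᵢ[ℝ] EuclideanSpace ℝ (Fin 4))}
    (h : ∀ i ∈ S, reflIn (root i) ∈ H) : groupOf S ≤ H :=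
  (Subgroup.closure_le _).2 (by rintro _ ⟨i, hi, rfl⟩; exact h i hi)

theorem groupOf_mono {S T : Set (Fin 24)} (h : S ⊆ T) : groupOf S ≤ groupOf T :=
  groupOf_le fun _ hi => reflIn_mem_groupOf (h hi)

theorem weylGroup_eq {Δ : Set (EuclideanSpace ℝ (Fin 4))} {S : Set (Fin 24)}
    (h1 : ∀ v ∈ Δ, ∃ i ∈ S, v = root i ∨ v = -root i) (h2 : ∀ i ∈ S, root i ∈ Δ) :
    weylGroup Δ = groupOf S := by
  refine le_antisymm ((Subgroup.closure_le _).2 ?_) (groupOf_le fun i hi =>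
    Subgroup.subset_closure ⟨_, h2 i hi, rfl⟩)
  rintro _ ⟨v, hv, rfl⟩
  obtain ⟨i, hi, rfl | rfl⟩ := h1 v hv
  · exact reflIn_mem_groupOf hi
  · rw [reflIn_neg]
    exact reflIn_mem_groupOf hi

theorem weylF4_eq : weylF4 = groupOf Set.univ :=
  weylGroup_eq (fun v hv => by simpa using exists_eq_root hv) fun i _ => root_mem_rootsF4 i

/-- The set `S` is stable under the reflections in its elements. -/
def Stable (S : Set (Fin 24)) : Prop :=
  ∀ i ∈ S, ∀ j ∈ S, image i j ∈ S

/-- The product of the linear forms that define the mirrors in `S`. -/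
def mirrorForm (S : Set (Fin 24)) (x : EuclideanSpace ℝ (Fin 4)) : ℝ :=
  open Classical in ∏ i ∈ S.toFinset, inner ℝ (root i) x

/-- The reflection in `i` permutes the linear forms of `S` up to sign, and the total sign is $-1$,
contributed by the form of `i` itself. -/
theorem mirrorForm_reflIn {S : Set (Fin 24)} (hS : Stable S) {i : Fin 24} (hi : i ∈ S)
    (x : EuclideanSpace ℝ (Fin 4)) : mirrorForm S (reflIn (root i) x) = -mirrorForm S x := by
  classical
  have hi' : i ∈ S.toFinset := Set.mem_toFinset.2 hi
  have hinner : ∀ j, inner ℝ (root j) (reflIn (root i) x) =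
      (imageSign i j : ℝ) * inner ℝ (root (image i j)) x := by
    intro j
    rw [← inner_reflIn_left, reflIn_root, real_inner_smul_left]
  have hne : ∀ j, j ≠ i → image i j ≠ i := by
    intro j hj h
    apply hj
    rw [← image_image i j, h, (image_self i).1]
  -- Roots exchanged by the reflection carry equal signs, which cancel in pairs; a root other than
  -- `i` fixed up to sign has sign `1`.
  have hsign : ∏ j ∈ S.toFinset.erase i, (imageSign i j : ℝ) = 1 := by
    refine Finset.prod_involution (fun j _ => image i j) ?_ ?_ ?_ ?_
    · intro j _
      rw [imageSign_image]
      rcases cast_imageSign i j with h | h <;> rw [h] <;> norm_num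
    · intro j hj h1 h2
      rcases imageSign_eq_one i j h2 with h | h
      · exact (Finset.mem_erase.1 hj).1 h.symm
      · simp [h] at h1
    · intro j hj
      rw [Finset.mem_erase, Set.mem_toFinset] at hj ⊢
      exact ⟨hne j hj.1, hS i hi j hj.2⟩
    · intro j _
      exact image_image i j
  have hprod : ∏ j ∈ S.toFinset.erase i, inner ℝ (root (image i j)) x =
      ∏ j ∈ S.toFinset.erase i, inner ℝ (root j) x := by
    refine Finset.prod_nbij' (image i) (image i) ?_ ?_ ?_ ?_ ?_
    · intro j hj
      rw [Finset.mem_erase, Set.mem_toFinset] at hj ⊢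
      exact ⟨hne j hj.1, hS i hi j hj.2⟩
    · intro j hj
      rw [Finset.mem_erase, Set.mem_toFinset] at hj ⊢
      exact ⟨hne j hj.1, hS i hi j hj.2⟩
    · exact fun j _ => image_image i j
    · exact fun j _ => image_image i j
    · exact fun j _ => rfl
  unfold mirrorForm
  rw [← Finset.mul_prod_erase _ _ hi', ← Finset.mul_prod_erase _ _ hi']
  simp only [hinner, Finset.prod_mul_distrib]
  rw [hsign, hprod, (image_self i).1, (image_self i).2]
  push_cast
  ring

theorem mirrorForm_apply {S : Set (Fin 24)} (hS : Stable S)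
    {g : EuclideanSpace ℝ (Fin 4) ≃ₗᵢ[ℝ] EuclideanSpace ℝ (Fin 4)} (hg : g ∈ groupOf S)
    (x : EuclideanSpace ℝ (Fin 4)) :
    mirrorForm S (g x) = LinearMap.det (g.toLinearEquiv :
      EuclideanSpace ℝ (Fin 4) →ₗ[ℝ] EuclideanSpace ℝ (Fin 4)) * mirrorForm S x := by
  induction hg using Subgroup.closure_induction generalizing x with
  | mem g hg =>
    obtain ⟨i, hi, rfl⟩ := hg
    rw [mirrorForm_reflIn hS hi, det_reflIn (root_ne_zero i)]
    ring
  | one =>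
    have : ((1 : EuclideanSpace ℝ (Fin 4) ≃ₗᵢ[ℝ] EuclideanSpace ℝ (Fin 4)).toLinearEquiv :
      EuclideanSpace ℝ (Fin 4) →ₗ[ℝ] EuclideanSpace ℝ (Fin 4)) = LinearMap.id := rfl
    rw [this, LinearMap.det_id, one_mul]
    rfl
  | mul g h _ _ h1 h2 =>
    have : ((g * h).toLinearEquiv :
      EuclideanSpace ℝ (Fin 4) →ₗ[ℝ] EuclideanSpace ℝ (Fin 4)) =
        (g.toLinearEquiv : EuclideanSpace ℝ (Fin 4) →ₗ[ℝ] EuclideanSpace ℝ (Fin 4)) ∘ₗ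
          h.toLinearEquiv := rfl
    rw [this, LinearMap.det_comp, mul_assoc, ← h2, ← h1]
    rfl
  | inv g _ h1 =>
    have h2 := h1 (g⁻¹ x)
    have h3 : g (g⁻¹ x) = x := g.apply_symm_apply x
    rw [h3] at h2
    have h4 : (g.toLinearEquiv : EuclideanSpace ℝ (Fin 4) →ₗ[ℝ] EuclideanSpace ℝ (Fin 4)) ∘ₗ
        (g⁻¹).toLinearEquiv = LinearMap.id := by
      ext1 y
      exact g.apply_symm_apply y
    have h5 := congrArg LinearMap.det h4
    rw [LinearMap.det_comp, LinearMap.det_id] at h5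
    rw [h2, ← mul_assoc, mul_comm (LinearMap.det _), h5, one_mul]

/-- The reflections in the group generated by a stable set of mirrors have their mirrors in that
set. -/
theorem exists_mem_span_of_reflIn_mem {S : Set (Fin 24)} (hS : Stable S)
    {v : EuclideanSpace ℝ (Fin 4)} (hv : v ≠ 0) (h : reflIn v ∈ groupOf S) :
    ∃ i ∈ S, v ∈ ℝ ∙ root i := by
  classical
  by_contra! hc
  -- A vector space over an infinite field is not a finite union of proper subspaces, so if every
  -- point of $v^\perp$ lay on a mirror, one mirror would contain $v^\perp$ and its root would be
  -- proportional to `v`.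
  have hcover : ∃ x : (ℝ ∙ v)ᗮ, ∀ i ∈ S, inner ℝ (root i) (x : EuclideanSpace ℝ (Fin 4)) ≠ 0 := by
    by_contra! hx
    let p : S → Submodule ℝ (ℝ ∙ v)ᗮ := fun i =>
      LinearMap.ker ((innerₗ _ (root i)).comp (ℝ ∙ v)ᗮ.subtype)
    have hp : (⋃ i, (p i : Set (ℝ ∙ v)ᗮ)) = Set.univ := by
      rw [Set.eq_univ_iff_forall]
      intro x
      obtain ⟨i, hi, h0⟩ := hx x
      exact Set.mem_iUnion.2 ⟨⟨i, hi⟩, h0⟩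
    obtain ⟨⟨i, hi⟩, hpi⟩ := Subspace.exists_eq_top_of_iUnion_eq_univ hp
    have hmem : root i ∈ ℝ ∙ v := by
      rw [← Submodule.orthogonal_orthogonal (ℝ ∙ v), Submodule.mem_orthogonal]
      intro x hx
      have : (⟨x, hx⟩ : (ℝ ∙ v)ᗮ) ∈ p ⟨i, hi⟩ := hpi ▸ Submodule.mem_top
      rw [real_inner_comm]
      exact this
    obtain ⟨c, hcv⟩ := Submodule.mem_span_singleton.1 hmem
    have hc0 : c ≠ 0 := by
      rintro rfl
      exact root_ne_zero i (by rw [← hcv, zero_smul])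
    exact hc i hi (Submodule.mem_span_singleton.2 ⟨c⁻¹, by rw [← hcv, inv_smul_smul₀ hc0]⟩)
  obtain ⟨x, hx⟩ := hcover
  have hx0 : mirrorForm S x ≠ 0 :=
    Finset.prod_ne_zero_iff.2 fun i hi => hx i (Set.mem_toFinset.1 hi)
  -- The reflection in `v` fixes `x` and has determinant $-1$, so the form at `x` equals its own
  -- negative.
  have h1 := mirrorForm_apply hS h x
  rw [det_reflIn hv, reflIn_eq_self_of_inner_eq_zero
    (Submodule.mem_orthogonal_singleton_iff_inner_right.1 x.2)] at h1
  apply hx0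
  linarith

end

end ReflectionSubgroup

/-! ### Normalized roots, angles, and the dictionary between subgroups and mirrors. -/

namespace ReflectionSubgroup

noncomputable section

/-- The positive roots of `F₄`, normalized to length `1`. -/
def unitRoot (i : Fin 24) : EuclideanSpace ℝ (Fin 4) :=
  ‖root i‖⁻¹ • root i

theorem reflIn_unitRoot (i : Fin 24) : reflIn (unitRoot i) = reflIn (root i) :=
  reflIn_smul (inv_ne_zero (norm_root_pos i).ne') _

theorem norm_unitRoot (i : Fin 24) : ‖unitRoot i‖ = 1 :=
  norm_smul_inv_norm (𝕜 := ℝ) (root_ne_zero i)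

theorem inner_unitRoot (i j : Fin 24) :
    inner ℝ (unitRoot i) (unitRoot j) = ‖root i‖⁻¹ * ‖root j‖⁻¹ * (gramZ i j / 4) := by
  rw [unitRoot, unitRoot, real_inner_smul_left, real_inner_smul_right, inner_root, mul_assoc]

theorem inner_unitRoot_sq (i j : Fin 24) :
    inner ℝ (unitRoot i) (unitRoot j) ^ 2 = (gramZ i j : ℝ) ^ 2 / (gramZ i i * gramZ j j) := by
  have h1 := gramZ_self_pos i
  have h2 := gramZ_self_pos j
  rw [inner_unitRoot, mul_pow, mul_pow, inv_pow, inv_pow, norm_root_sq, norm_root_sq]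
  field_simp

theorem inner_unitRoot_of_neg {i j : Fin 24} (h : gramZ i j < 0) :
    inner ℝ (unitRoot i) (unitRoot j) < 0 := by
  have h1 := inv_pos.2 (norm_root_pos i)
  have h2 := inv_pos.2 (norm_root_pos j)
  have h3 : (gramZ i j : ℝ) < 0 := by exact_mod_cast h
  rw [inner_unitRoot]
  exact mul_neg_of_pos_of_neg (mul_pos h1 h2) (by linarith)

theorem inner_unitRoot_sq_cases (i j : Fin 24) :
    (angle i j = 1 ∧ i = j) ∨
    (angle i j = 2 ∧ inner ℝ (unitRoot i) (unitRoot j) ^ 2 = 0) ∨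
    ((angle i j = 3 ∨ angle i j = 5) ∧ inner ℝ (unitRoot i) (unitRoot j) ^ 2 = 1 / 4) ∨
    ((angle i j = 4 ∨ angle i j = 6) ∧ inner ℝ (unitRoot i) (unitRoot j) ^ 2 = 1 / 2) := by
  have h1 := gramZ_self_pos i
  have h2 := gramZ_self_pos j
  have h4 : 4 * gramZ i j ^ 2 = gramZ i i * gramZ j j →
      inner ℝ (unitRoot i) (unitRoot j) ^ 2 = 1 / 4 := by
    intro h
    have : (4 : ℝ) * gramZ i j ^ 2 = gramZ i i * gramZ j j := by exact_mod_cast h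
    rw [inner_unitRoot_sq]
    field_simp
    linarith
  have h5 : 2 * gramZ i j ^ 2 = gramZ i i * gramZ j j →
      inner ℝ (unitRoot i) (unitRoot j) ^ 2 = 1 / 2 := by
    intro h
    have : (2 : ℝ) * gramZ i j ^ 2 = gramZ i i * gramZ j j := by exact_mod_cast h
    rw [inner_unitRoot_sq]
    field_simp
    linarith
  rcases angle_spec i j with h | h | h | h | h | h
  · exact Or.inl h
  · refine Or.inr (Or.inl ⟨h.1, ?_⟩)
    rw [inner_unitRoot_sq, h.2]
    simp
  · exact Or.inr (Or.inr (Or.inl ⟨Or.inl h.1, h4 h.2.2⟩))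
  · exact Or.inr (Or.inr (Or.inr ⟨Or.inl h.1, h5 h.2.2⟩))
  · exact Or.inr (Or.inr (Or.inl ⟨Or.inr h.1, h4 h.2.2⟩))
  · exact Or.inr (Or.inr (Or.inr ⟨Or.inr h.1, h5 h.2.2⟩))

/-- The angle codes up to `4` are chosen to be the Coxeter labels: code $m$ means inner product
$-\cos(\pi/m)$, including $m=1$ for equal roots. Codes `5` and `6` are the acute angles. -/
theorem inner_unitRoot_eq {i j : Fin 24} (h : angle i j ≤ 4) :
    inner ℝ (unitRoot i) (unitRoot j) = -Real.cos (Real.pi / (angle i j : ℝ)) := by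
  rcases angle_spec i j with h1 | h1 | h1 | h1 | h1 | h1
  · rw [h1.1, h1.2, real_inner_self_eq_norm_sq, norm_unitRoot]
    simp
  · rw [h1.1, inner_unitRoot, h1.2]
    simp
  · have h3 := inner_unitRoot_of_neg h1.2.1
    rcases inner_unitRoot_sq_cases i j with h2 | h2 | h2 | h2 <;> try omega
    rw [h1.1]
    push_cast
    rw [Real.cos_pi_div_three]
    nlinarith [h2.2]
  · have h3 := inner_unitRoot_of_neg h1.2.1
    rcases inner_unitRoot_sq_cases i j with h2 | h2 | h2 | h2 <;> try omega
    rw [h1.1]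
    push_cast
    rw [Real.cos_pi_div_four]
    have h4 : (inner ℝ (unitRoot i) (unitRoot j)) ^ 2 = (√2 / 2) ^ 2 := by
      rw [h2.2, div_pow, Real.sq_sqrt (by norm_num)]
      norm_num
    rcases sq_eq_sq_iff_eq_or_eq_neg.1 h4 with h5 | h5
    · have : 0 ≤ √2 / 2 := by positivity
      linarith
    · exact h5
  · omega
  · omega

theorem angle_self (i : Fin 24) : angle i i = 1 := by
  rcases inner_unitRoot_sq_cases i i with h | h | h | h
  · exact h.1
  all_goals
    have := h.2
    rw [real_inner_self_eq_norm_sq, norm_unitRoot] at this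
    norm_num at this

theorem eq_of_root_mem_span {i j : Fin 24} (h : root i ∈ ℝ ∙ root j) : i = j := by
  obtain ⟨c, hc⟩ := Submodule.mem_span_singleton.1 h
  have h1 := inner_root i i
  have h2 := inner_root i j
  have h0 := inner_root j j
  rw [← hc, real_inner_smul_left] at h2
  rw [← hc, real_inner_smul_left, real_inner_smul_right] at h1
  have h3 : inner ℝ (unitRoot i) (unitRoot j) ^ 2 = 1 := by
    have h4 := gramZ_self_pos i
    have h5 := gramZ_self_pos j
    rw [inner_unitRoot_sq, div_eq_one_iff_eq (by positivity)]
    rw [h0] at h1 h2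
    have h6 : (gramZ i j : ℝ) = c * gramZ j j := by linarith
    have h7 : (gramZ i i : ℝ) = c * (c * gramZ j j) := by linarith
    rw [h6, h7]
    ring
  rcases inner_unitRoot_sq_cases i j with h1 | h1 | h1 | h1
  · exact h1.2
  all_goals
    rw [h3] at h1
    norm_num at h1

/-- Distinct positive roots that form pairwise non-acute angles are linearly independent. -/
theorem linearIndependent_root {B : Type*} {t : B → Fin 24}
    (h : ∀ p q, p ≠ q → 2 ≤ angle (t p) (t q) ∧ angle (t p) (t q) ≤ 4) :
    LinearIndependent ℝ fun p => root (t p) := by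
  -- Vectors in an open half-space with pairwise nonpositive inner products are linearly
  -- independent.
  obtain ⟨c, hc⟩ := exists_functional_pos
  refine LinearMap.BilinForm.linearIndependent_of_pairwise_le_zero
    (innerₗ (EuclideanSpace ℝ (Fin 4))) ?_
    (innerₗ (EuclideanSpace ℝ (Fin 4)) (WithLp.toLp 2 fun k => (c k : ℝ))) _ ?_ ?_
  · intro x hx
    exact real_inner_self_pos.2 hx
  · intro p
    have : (0 : ℝ) < c 0 * rootZ (t p) 0 + c 1 * rootZ (t p) 1 + c 2 * rootZ (t p) 2 +
        c 3 * rootZ (t p) 3 := by exact_mod_cast hc (t p)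
    simp only [innerₗ_apply_apply, PiLp.inner_apply, Fin.sum_univ_four, root_apply,
      RCLike.inner_apply, conj_trivial]
    linarith
  · intro p q hpq
    have h1 := h p q hpq
    change inner ℝ (root (t p)) (root (t q)) ≤ 0
    have : gramZ (t p) (t q) ≤ 0 := by
      rcases angle_spec (t p) (t q) with h2 | h2 | h2 | h2 | h2 | h2 <;> omega
    have h2 : (gramZ (t p) (t q) : ℝ) ≤ 0 := by exact_mod_cast this
    rw [inner_root]
    linarith

theorem hasType_groupOf {B : Type*} {t : B → Fin 24} {M : CoxeterMatrix B}
    (h : ∀ p q, M p q = angle (t p) (t q)) (h4 : ∀ p q, angle (t p) (t q) ≤ 4) :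
    HasType (groupOf (Set.range t)) M := by
  refine ⟨fun p => unitRoot (t p), ?_, fun p q => ?_, ?_⟩
  · have hl : LinearIndependent ℝ fun p => root (t p) := by
      refine linearIndependent_root fun p q hpq => ⟨?_, h4 p q⟩
      have h1 := M.off_diagonal p q hpq
      have h2 : M.M p q = angle (t p) (t q) := h p q
      rcases angle_spec (t p) (t q) with h3 | h3 | h3 | h3 | h3 | h3 <;> omega
    exact hl.units_smul fun p => Units.mk0 _ (inv_ne_zero (norm_root_pos (t p)).ne')
  · rw [inner_unitRoot_eq (h4 p q), ← h p q]
  · rw [groupOf, ← Set.range_comp]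
    congr 2
    ext1 p
    exact reflIn_unitRoot _

/-- The set of the mirrors of a group. -/
def mirrors (H : Subgroup (EuclideanSpace ℝ (Fin 4) ≃ₗᵢ[ℝ] EuclideanSpace ℝ (Fin 4))) :
    Set (Fin 24) :=
  {i | reflIn (root i) ∈ H}

theorem stable_mirrors
    (H : Subgroup (EuclideanSpace ℝ (Fin 4) ≃ₗᵢ[ℝ] EuclideanSpace ℝ (Fin 4))) :
    Stable (mirrors H) := by
  intro i hi j hj
  change reflIn _ ∈ H
  rw [reflIn_root_image]
  exact H.mul_mem (H.mul_mem hi hj) hi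

theorem stable_univ : Stable Set.univ :=
  fun _ _ _ _ => Set.mem_univ _

/-- With `groupOf_mirrors`, this makes stable sets of mirrors and reflection subgroups correspond
bijectively. -/
theorem mirrors_groupOf {S : Set (Fin 24)} (hS : Stable S) : mirrors (groupOf S) = S := by
  ext i
  refine ⟨fun h => ?_, fun h => reflIn_mem_groupOf h⟩
  obtain ⟨j, hj, hij⟩ := exists_mem_span_of_reflIn_mem hS (root_ne_zero i) h
  rwa [eq_of_root_mem_span hij]

theorem exists_mem_span_root {v : EuclideanSpace ℝ (Fin 4)} (hv : v ≠ 0)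
    (h : reflIn v ∈ weylF4) : ∃ i, v ∈ ℝ ∙ root i := by
  rw [weylF4_eq] at h
  obtain ⟨i, -, hi⟩ := exists_mem_span_of_reflIn_mem stable_univ hv h
  exact ⟨i, hi⟩

theorem groupOf_mirrors
    {H : Subgroup (EuclideanSpace ℝ (Fin 4) ≃ₗᵢ[ℝ] EuclideanSpace ℝ (Fin 4))}
    (hH : IsReflectionSubgroup weylF4 H) : groupOf (mirrors H) = H := by
  refine le_antisymm (groupOf_le fun i hi => hi) ?_
  obtain ⟨hle, T, hT, rfl⟩ := hH
  refine (Subgroup.closure_le _).2 fun g hg => ?_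
  obtain ⟨v, hv, rfl⟩ := hT g hg
  have hgT := Subgroup.subset_closure hg
  obtain ⟨i, hi⟩ := exists_mem_span_root hv (hle hgT)
  rw [reflIn_eq_of_mem_span hv hi] at hgT ⊢
  exact reflIn_mem_groupOf hgT

theorem isReflectionSubgroup_groupOf (S : Set (Fin 24)) :
    IsReflectionSubgroup weylF4 (groupOf S) := by
  refine ⟨?_, _, ?_, rfl⟩
  · rw [weylF4_eq]
    exact groupOf_mono (Set.subset_univ S)
  · rintro _ ⟨i, -, rfl⟩
    exact ⟨root i, root_ne_zero i, rfl⟩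

/-! ### Simple roots of a reflection subgroup and its rank. -/

/-- The mirrors in `S` whose reflection is not generated by the preceding mirrors. -/
def simples (S : Set (Fin 24)) : Set (Fin 24) :=
  {i ∈ S | reflIn (root i) ∉ groupOf {j ∈ S | j < i}}

theorem groupOf_simples (S : Set (Fin 24)) : groupOf (simples S) = groupOf S := by
  refine le_antisymm (groupOf_mono (Set.sep_subset _ _)) (groupOf_le fun i hi => ?_)
  induction i using WellFoundedLT.induction with
  | ind i ih =>
    by_cases h : reflIn (root i) ∈ groupOf {j ∈ S | j < i}
    · exact groupOf_le (fun j hj => ih j hj.2 hj.1) h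
    · exact reflIn_mem_groupOf ⟨hi, h⟩

/-- If `i < j` form an acute angle, the reflection in `j` is the conjugate by the reflection in `i`
of the one in `image i j`. Both are earlier mirrors of `S`, so `j` would not be simple. -/
theorem angle_le_four_of_mem_simples {S : Set (Fin 24)} (hS : Stable S) {i j : Fin 24}
    (hi : i ∈ simples S) (hj : j ∈ simples S) : angle i j ≤ 4 := by
  wlog hij : i < j generalizing i j
  · rcases (not_lt.1 hij).eq_or_lt with rfl | h
    · rw [angle_self]
      norm_num
    · rw [angle_comm]
      exact this hj hi h
  by_contra! h
  have hk := image_lt i j hij h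
  have hkS := hS i hi.1 j hj.1
  apply hj.2
  have := reflIn_root_image i (image i j)
  rw [image_image] at this
  rw [this]
  have h1 : reflIn (root i) ∈ groupOf {k ∈ S | k < j} := reflIn_mem_groupOf ⟨hi.1, hij⟩
  exact mul_mem (mul_mem h1 (reflIn_mem_groupOf ⟨hkS, hk⟩)) h1

theorem rank_groupOf (S : Set (Fin 24)) :
    rank (groupOf S) = Module.finrank ℝ (Submodule.span ℝ (root '' S)) := by
  have : Submodule.span ℝ {v : EuclideanSpace ℝ (Fin 4) | v ≠ 0 ∧ reflIn v ∈ groupOf S} =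
      Submodule.span ℝ (root '' S) := by
    refine le_antisymm (Submodule.span_le.2 ?_) (Submodule.span_mono ?_)
    · rintro v ⟨hv, h⟩
      rw [groupOf_eq] at h
      exact mem_span_of_reflIn_mem_closure hv h
    · rintro _ ⟨i, hi, rfl⟩
      exact ⟨root_ne_zero i, reflIn_mem_groupOf hi⟩
  rw [rank, this]

theorem linearIndependent_simples {S : Set (Fin 24)} (hS : Stable S) :
    LinearIndependent ℝ fun i : simples S => root i := by
  refine linearIndependent_root fun p q hpq => ⟨?_, angle_le_four_of_mem_simples hS p.2 q.2⟩
  rcases angle_spec p q with h | h | h | h | h | h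
  · exact absurd (Subtype.ext h.2) hpq
  all_goals omega

theorem ncard_simples_le {S : Set (Fin 24)} (hS : Stable S) : (simples S).ncard ≤ 4 := by
  classical
  have := (linearIndependent_simples hS).fintype_card_le_finrank
  rw [finrank_euclideanSpace_fin, ← Nat.card_eq_fintype_card] at this
  exact this

theorem ncard_simples {S : Set (Fin 24)} (hS : Stable S) :
    (simples S).ncard = rank (groupOf S) := by
  classical
  rw [← groupOf_simples, rank_groupOf, Set.image_eq_range,
    finrank_span_eq_card (linearIndependent_simples hS), ← Nat.card_eq_fintype_card]
  rfl

/-- The simple roots of a group given by its Coxeter diagram lie, up to scaling, in `F₄`. -/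
theorem HasType.exists_roots {B : Type*} {M : CoxeterMatrix B}
    {H : Subgroup (EuclideanSpace ℝ (Fin 4) ≃ₗᵢ[ℝ] EuclideanSpace ℝ (Fin 4))}
    (hH : HasType H M) (hle : H ≤ weylF4) :
    ∃ t : B → Fin 24, groupOf (Set.range t) = H ∧ ∀ p q,
      inner ℝ (unitRoot (t p)) (unitRoot (t q)) ^ 2 = Real.cos (Real.pi / (M p q : ℝ)) ^ 2 := by
  obtain ⟨a, ha, hai, rfl⟩ := hH
  have hmem : ∀ p, reflIn (a p) ∈ weylF4 := fun p => hle (Subgroup.subset_closure ⟨p, rfl⟩)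
  choose t ht using fun p => exists_mem_span_root (ha.ne_zero p) (hmem p)
  refine ⟨t, ?_, fun p q => ?_⟩
  · rw [groupOf, ← Set.range_comp]
    congr 2
    ext1 p
    exact (reflIn_eq_of_mem_span (ha.ne_zero p) (ht p)).symm
  · have hnorm : ∀ p, ‖a p‖ = 1 := by
      intro p
      have h := hai p p
      have hd : M.M p p = 1 := M.diagonal p
      rw [hd, real_inner_self_eq_norm_sq] at h
      simp only [Nat.cast_one, div_one, Real.cos_pi, neg_neg] at h
      exact (pow_eq_one_iff_of_nonneg (norm_nonneg _) two_ne_zero).1 h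
    -- Both vectors are of length one on the same line, so they differ by a sign; squaring the inner
    -- products removes it.
    have hc : ∀ p, ∃ c : ℝ, c ^ 2 = 1 ∧ a p = c • unitRoot (t p) := by
      intro p
      obtain ⟨c, hc⟩ := Submodule.mem_span_singleton.1 (ht p)
      have h0 := (norm_root_pos (t p)).ne'
      have hcu : a p = (c * ‖root (t p)‖) • unitRoot (t p) := by
        rw [unitRoot, smul_smul, mul_assoc, mul_inv_cancel₀ h0, mul_one, hc]
      refine ⟨_, ?_, hcu⟩
      have := congrArg norm hcu
      rw [norm_smul, norm_unitRoot, hnorm, mul_one, Real.norm_eq_abs] at this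
      rw [← sq_abs, ← this, one_pow]
    obtain ⟨c, hc1, hc2⟩ := hc p
    obtain ⟨d, hd1, hd2⟩ := hc q
    have h := hai p q
    rw [hc2, hd2, real_inner_smul_left, real_inner_smul_right] at h
    have h2 := congrArg (· ^ 2) h
    simp only [mul_pow, hc1, hd1, one_mul, neg_sq] at h2
    exact h2

theorem angle_of_cos_two {i j : Fin 24} {m : ℕ} (hm : m = 2)
    (h : inner ℝ (unitRoot i) (unitRoot j) ^ 2 = Real.cos (Real.pi / (m : ℝ)) ^ 2) :
    angle i j = 2 := by
  subst hm
  push_cast at h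
  rw [Real.cos_pi_div_two] at h
  rcases inner_unitRoot_sq_cases i j with h1 | h1 | h1 | h1
  · rw [h1.2, real_inner_self_eq_norm_sq, norm_unitRoot] at h
    norm_num at h
  · exact h1.1
  all_goals
    rw [h1.2] at h
    norm_num at h

/-- The squared cosine cannot distinguish an obtuse angle from its supplement, whence two codes. -/
theorem angle_of_cos_three {i j : Fin 24} {m : ℕ} (hm : m = 3)
    (h : inner ℝ (unitRoot i) (unitRoot j) ^ 2 = Real.cos (Real.pi / (m : ℝ)) ^ 2) :
    angle i j = 3 ∨ angle i j = 5 := by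
  subst hm
  push_cast at h
  rw [Real.cos_pi_div_three] at h
  rcases inner_unitRoot_sq_cases i j with h1 | h1 | h1 | h1
  · rw [h1.2, real_inner_self_eq_norm_sq, norm_unitRoot] at h
    norm_num at h
  · rw [h1.2] at h
    norm_num at h
  · exact h1.1
  · rw [h1.2] at h
    norm_num at h

theorem angle_of_cos_four {i j : Fin 24} {m : ℕ} (hm : m = 4)
    (h : inner ℝ (unitRoot i) (unitRoot j) ^ 2 = Real.cos (Real.pi / (m : ℝ)) ^ 2) :
    angle i j = 4 ∨ angle i j = 6 := by
  subst hm
  push_cast at h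
  rw [Real.cos_pi_div_four, div_pow, Real.sq_sqrt (by norm_num)] at h
  rcases inner_unitRoot_sq_cases i j with h1 | h1 | h1 | h1
  · rw [h1.2, real_inner_self_eq_norm_sq, norm_unitRoot] at h
    norm_num at h
  · rw [h1.2] at h
    norm_num at h
  · rw [h1.2] at h
    norm_num at h
  · exact h1.1

/-- The group preserves the finite set of roots, and the standard basis consists of roots, so an
element is determined by four roots. -/
theorem finite_weylF4 : Finite weylF4 := by
  have hroots : rootsF4.Finite := by
    refine ((Set.finite_range root).union (Set.finite_range fun i => -root i)).subset ?_
    intro v hv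
    obtain ⟨i, rfl | rfl⟩ := exists_eq_root hv
    · exact Or.inl ⟨i, rfl⟩
    · exact Or.inr ⟨i, rfl⟩
  have hroot : ∀ i j, reflIn (root i) (root j) ∈ rootsF4 := by
    intro i j
    rw [reflIn_root]
    rcases cast_imageSign i j with h | h <;> rw [h]
    · rw [one_smul]
      exact root_mem_rootsF4 _
    · rw [neg_one_smul]
      exact neg_mem_rootsF4 (root_mem_rootsF4 _)
  have hrefl : ∀ i, ∀ v ∈ rootsF4, reflIn (root i) v ∈ rootsF4 := by
    intro i v hv
    obtain ⟨j, rfl | rfl⟩ := exists_eq_root hv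
    · exact hroot i j
    · rw [map_neg]
      exact neg_mem_rootsF4 (hroot i j)
  have hpres : ∀ g ∈ weylF4, ∀ v ∈ rootsF4, g v ∈ rootsF4 := by
    intro g hg
    rw [weylF4_eq] at hg
    induction hg using Subgroup.closure_induction'' with
    | mem g hg =>
      obtain ⟨i, -, rfl⟩ := hg
      exact hrefl i
    | inv_mem g hg =>
      obtain ⟨i, -, rfl⟩ := hg
      change ∀ v ∈ rootsF4, (reflIn (root i))⁻¹ v ∈ rootsF4
      rw [reflIn_inv]
      exact hrefl i
    | one => exact fun v hv => hv
    | mul g h _ _ h1 h2 => exact fun v hv => h1 _ (h2 v hv)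
  have : Finite rootsF4 := hroots
  let b := EuclideanSpace.basisFun (Fin 4) ℝ
  have hb : ∀ i, b i ∈ rootsF4 := fun i => Or.inl (Or.inr ⟨i, 1, Or.inl rfl, by simp [b]⟩)
  refine Finite.of_injective
    (fun (g : weylF4) (i : Fin 4) => (⟨g.1 (b i), hpres g.1 g.2 _ (hb i)⟩ : rootsF4)) ?_
  intro g h hgh
  refine Subtype.ext (LinearIsometryEquiv.toLinearEquiv_injective (b.toBasis.ext' fun i => ?_))
  have := congrArg Subtype.val (congrFun hgh i)
  simpa using this

end

end ReflectionSubgroup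

/-! ### Lists of subgroups and the finite verifications. -/

namespace ReflectionSubgroup

/-- The set of the bits of a number. -/
def bitSet (m : ℕ) : Set (Fin 24) :=
  {i | m.testBit i = true}

/-- The simple roots and the mirrors (as a bit set) of the reflection subgroups of type `B₄`. -/
def subgroupsB4 : List ((Fin 4 → Fin 24) × ℕ) :=
  [(![10, 2, 1, 0], 0xe6ade7), (![11, 3, 0, 1], 0xd95edb), (![0, 3, 6, 2], 0x5f7a5d),
    (![6, 3, 0, 5], 0x79db79), (![1, 2, 7, 3], 0xafb5ae), (![7, 2, 1, 4], 0xb6e7b6)]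

/-- The simple roots and the mirrors (as a bit set) of the reflection subgroups of type `2A₂`. -/
def subgroups2A2 : List ((Fin 4 → Fin 24) × ℕ) :=
  [(![0, 3, 2, 21], 0xa0001d), (![0, 19, 2, 10], 0x188405), (![0, 9, 13, 15], 0x80b201),
    (![0, 14, 10, 13], 0x216401), (![1, 2, 3, 20], 0x50002e), (![1, 18, 3, 11], 0x24480a),
    (![1, 8, 12, 14], 0x407102), (![1, 15, 11, 12], 0x129802), (![2, 7, 4, 19], 0x480194),
    (![3, 6, 5, 18], 0x840268), (![4, 6, 8, 17], 0x821150), (![4, 11, 7, 17], 0x230890),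
    (![5, 10, 6, 16], 0x130460), (![5, 7, 9, 16], 0x4122a0), (![6, 14, 8, 10], 0xc4540),
    (![7, 15, 9, 11], 0xc8a80)]

/-- The simple roots and the positive roots (as a bit set) of one closed root subsystem for each
of the types `F₄`, `B₄`, `D₄`, `2A₂`, `A₃ + A₁`, `B₃ + A₁`, `B₂ + 2A₁` and `4A₁`. -/
def closedSubsystems : List ((Fin 4 → Fin 24) × ℕ) :=
  [(![2, 1, 0, 3], 0xffffff), (![10, 2, 1, 0], 0xe6ade7), (![1, 2, 7, 10], 0xa6a5a6),
    (![0, 3, 2, 21], 0xa0001d), (![2, 10, 13, 0], 0xa0a405), (![3, 0, 1, 23], 0x8016db),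
    (![0, 1, 10, 23], 0x8004c3), (![1, 7, 10, 23], 0x800482)]

/-- Simple roots of a reflection subgroup of type `2B₂`. -/
def roots2B2 : Fin 4 → Fin 24 :=
  ![0, 1, 10, 11]

/-- The entries of a Coxeter matrix, as a function of two indices. -/
def entry {B : Type*} (M : CoxeterMatrix B) (p q : B) : ℕ :=
  M p q

/-- The roots `t` are pairwise non-acute, and generate the mirrors in `m`. -/
def IsSimpleSystem (t : Fin 4 → Fin 24) (m : ℕ) : Prop :=
  (∀ p q, angle (t p) (t q) ≤ 4) ∧ (∀ p q, angle (t p) (t q) = 1 → p = q) ∧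
  (∀ p, m.testBit (t p) = true) ∧
  (∀ i : Fin 24, m.testBit i = true → ∀ j : Fin 24, m.testBit j = true →
    m.testBit (image i j) = true) ∧
  ∀ i : Fin 24, m.testBit i = true → ∃ p, i = t p ∨ image (t p) i < i

instance (t : Fin 4 → Fin 24) (m : ℕ) : Decidable (IsSimpleSystem t m) :=
  inferInstanceAs (Decidable (_ ∧ _))

/-- The roots `a, b, c, d` form the same angles as the roots `t`. -/
def SameAngles (a b c d : Fin 24) (t : Fin 4 → Fin 24) : Prop :=
  angle a b = angle (t 0) (t 1) ∧ angle a c = angle (t 0) (t 2) ∧ angle a d = angle (t 0) (t 3) ∧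
  angle b c = angle (t 1) (t 2) ∧ angle b d = angle (t 1) (t 3) ∧ angle c d = angle (t 2) (t 3)

instance (a b c d : Fin 24) (t : Fin 4 → Fin 24) : Decidable (SameAngles a b c d t) :=
  inferInstanceAs (Decidable (_ ∧ _))

theorem isSimpleSystem_B4 : ∀ x ∈ subgroupsB4, IsSimpleSystem x.1 x.2 := by
  decide +kernel

theorem isSimpleSystem_2A2 : ∀ x ∈ subgroups2A2, IsSimpleSystem x.1 x.2 := by
  decide +kernel

theorem isSimpleSystem_closedSubsystems :
    ∀ x ∈ closedSubsystems, IsSimpleSystem x.1 x.2 := by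
  decide +kernel

theorem angle_subgroupsB4 : ∀ x ∈ subgroupsB4, ∀ p q,
    entry (CoxeterMatrix.B 4) p q = angle (x.1 p) (x.1 q) := by
  decide +kernel

theorem angle_subgroups2A2 : ∀ x ∈ subgroups2A2, ∀ p q,
    entry (disjointUnion (CoxeterMatrix.A 2) (CoxeterMatrix.A 2)) p q =
      angle (x.1 (finSumFinEquiv p)) (x.1 (finSumFinEquiv q)) := by
  decide +kernel

theorem angle_roots2B2 : (∀ p q, entry (disjointUnion (CoxeterMatrix.B 2) (CoxeterMatrix.B 2)) p q =
      angle (roots2B2 (finSumFinEquiv p)) (roots2B2 (finSumFinEquiv q))) ∧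
    (∀ p q, angle (roots2B2 p) (roots2B2 q) ≤ 4) ∧
    ∀ p q, angle (roots2B2 p) (roots2B2 q) = 1 → p = q := by
  decide +kernel

theorem exists_not_testBit : ∀ x ∈ subgroupsB4 ++ subgroups2A2, ∃ i : Fin 24,
    x.2.testBit i = false := by
  decide +kernel

/-- In the standard model of $B_4$, an $A_2$ uses three coordinates up to signs, and the only mirror
orthogonal to it is that of the fourth coordinate vector, so there is no room for a second $A_2$. -/
theorem no_2A2_in_B4 : ∀ x ∈ subgroupsB4, ∀ i j : Fin 24,
    x.2.testBit i = true → x.2.testBit j = true → (angle i j = 3 ∨ angle i j = 5) →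
    ∀ k : Fin 24, x.2.testBit k = true → angle i k = 2 → angle j k = 2 →
    ∀ l : Fin 24, x.2.testBit l = true → angle i l = 2 → angle j l = 2 →
    ¬ (angle k l = 3 ∨ angle k l = 5) := by
  decide +kernel

/-- Distinct mirrors of $2A_2$ meet only at angles $\pi/2$ and $\pi/3$. -/
theorem no_B2_in_2A2 : ∀ x ∈ subgroups2A2, ∀ i j : Fin 24,
    x.2.testBit i = true → x.2.testBit j = true → ¬ (angle i j = 4 ∨ angle i j = 6) := by
  decide +kernel

theorem exists_maximal_testBit : ∀ i j, i ≤ j → angle i j ≤ 4 →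
    ∀ k, j ≤ k → angle i k ≤ 4 → angle j k ≤ 4 →
    ∀ l, k ≤ l → angle i l ≤ 4 → angle j l ≤ 4 → angle k l ≤ 4 →
    (∃ x ∈ subgroupsB4 ++ subgroups2A2, x.2.testBit i = true ∧ x.2.testBit j = true ∧
      x.2.testBit k = true ∧ x.2.testBit l = true) ∨ (i = 0 ∧ j = 1 ∧ k = 2 ∧ l = 3) := by
  decide +kernel

theorem generate_all : ∀ i : Fin 24, i = 0 ∨ i = 1 ∨ i = 2 ∨ i = 3 ∨
    image 0 i < i ∨ image 1 i < i ∨ image 2 i < i ∨ image 3 i < i := by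
  decide +kernel

/-- The roots in the list `L` can be ordered so that they form the same angles as the simple roots
of type `2B₂`, or as the simple roots of one of the listed closed subsystems. -/
def HasListedAngles (L : List (Fin 24)) : Prop :=
  ∃ a ∈ L, ∃ b ∈ L, b ≠ a ∧ ∃ c ∈ L, c ≠ a ∧ c ≠ b ∧ ∃ d ∈ L, d ≠ a ∧ d ≠ b ∧ d ≠ c ∧
    (SameAngles a b c d roots2B2 ∨ ∃ x ∈ closedSubsystems, SameAngles a b c d x.1)

instance (L : List (Fin 24)) : Decidable (HasListedAngles L) := by
  unfold HasListedAngles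
  infer_instance

/-- Strict inequalities restrict to four distinct simple roots, that is, to rank 4. -/
theorem hasListedAngles : ∀ i j, i < j → angle i j ≤ 4 →
    ∀ k, j < k → angle i k ≤ 4 → angle j k ≤ 4 →
    ∀ l, k < l → angle i l ≤ 4 → angle j l ≤ 4 → angle k l ≤ 4 →
    HasListedAngles [i, j, k, l] := by
  decide +kernel

/-- Closedness in terms of positive roots: up to a global sign, these four equations are all the
ways in which a sum of two signed roots of the subsystem can be a signed root outside it. -/
theorem closedSubsystems_add : ∀ x ∈ closedSubsystems, ∀ k : Fin 24, x.2.testBit k = false →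
    ∀ i : Fin 24, x.2.testBit i = true → ∀ j : Fin 24, x.2.testBit j = true →
    (¬ ∀ c, rootZ i c + rootZ j c = rootZ k c) ∧ (¬ ∀ c, rootZ i c + rootZ j c = -rootZ k c) ∧
    (¬ ∀ c, rootZ i c - rootZ j c = rootZ k c) ∧ ¬ ∀ c, rootZ i c - rootZ j c = -rootZ k c := by
  decide +kernel

/-- In the doubled coordinates, squared length `4` means short. This is the obstruction to a closed
$2B_2$. -/
theorem exists_sum_of_short : ∀ i j, gramZ i i = 4 → gramZ j j = 4 → angle i j = 2 →
    ∃ k, ∀ c, rootZ k c = rootZ i c + rootZ j c := by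
  decide +kernel

end ReflectionSubgroup

/-! ### Classification of the maximal reflection subgroups. -/

namespace ReflectionSubgroup

noncomputable section

theorem IsSimpleSystem.stable {t : Fin 4 → Fin 24} {m : ℕ} (h : IsSimpleSystem t m) :
    Stable (bitSet m) :=
  fun i hi j hj => h.2.2.2.1 i hi j hj

/-- Descent: a mirror of `m` that is not simple is moved to an earlier mirror by a simple
reflection, so its reflection is a conjugate of one already generated. -/
theorem IsSimpleSystem.groupOf_eq {t : Fin 4 → Fin 24} {m : ℕ} (h : IsSimpleSystem t m) :
    groupOf (Set.range t) = groupOf (bitSet m) := by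
  refine le_antisymm (groupOf_mono ?_) (groupOf_le fun i hi => ?_)
  · rintro _ ⟨p, rfl⟩
    exact h.2.2.1 p
  · induction i using WellFoundedLT.induction with
    | ind i ih =>
      obtain ⟨p, rfl | hp⟩ := h.2.2.2.2 i hi
      · exact reflIn_mem_groupOf ⟨p, rfl⟩
      · have h1 := ih _ hp (h.stable _ (h.2.2.1 p) _ hi)
        have h2 : reflIn (root (t p)) ∈ groupOf (Set.range t) := reflIn_mem_groupOf ⟨p, rfl⟩
        have h3 := reflIn_root_image (t p) (image (t p) i)
        rw [image_image] at h3
        rw [h3]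
        exact mul_mem (mul_mem h2 h1) h2

theorem hasType_subgroupsB4 {x : (Fin 4 → Fin 24) × ℕ} (hx : x ∈ subgroupsB4) :
    HasType (groupOf (bitSet x.2)) (CoxeterMatrix.B 4) := by
  have h := isSimpleSystem_B4 x hx
  rw [← h.groupOf_eq]
  exact hasType_groupOf (angle_subgroupsB4 x hx) h.1

theorem hasType_subgroups2A2 {x : (Fin 4 → Fin 24) × ℕ} (hx : x ∈ subgroups2A2) :
    HasType (groupOf (bitSet x.2)) (disjointUnion (CoxeterMatrix.A 2) (CoxeterMatrix.A 2)) := by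
  have h := isSimpleSystem_2A2 x hx
  rw [← h.groupOf_eq, ← EquivLike.range_comp x.1 (finSumFinEquiv (m := 2) (n := 2))]
  exact hasType_groupOf (angle_subgroups2A2 x hx) fun p q => h.1 _ _

theorem hasType_roots2B2 : HasType (groupOf (Set.range roots2B2))
    (disjointUnion (CoxeterMatrix.B 2) (CoxeterMatrix.B 2)) := by
  rw [← EquivLike.range_comp roots2B2 (finSumFinEquiv (m := 2) (n := 2))]
  exact hasType_groupOf angle_roots2B2.1 fun p q => angle_roots2B2.2.1 _ _

theorem rank_groupOf_range {t : Fin 4 → Fin 24} (h4 : ∀ p q, angle (t p) (t q) ≤ 4)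
    (h1 : ∀ p q, angle (t p) (t q) = 1 → p = q) : rank (groupOf (Set.range t)) = 4 := by
  have hl : LinearIndependent ℝ fun p => root (t p) := by
    refine linearIndependent_root fun p q hpq => ⟨?_, h4 p q⟩
    rcases angle_spec (t p) (t q) with h | h | h | h | h | h
    · exact absurd (h1 p q h.1) hpq
    all_goals omega
  rw [rank_groupOf, ← Set.range_comp]
  exact (finrank_span_eq_card hl).trans (Fintype.card_fin 4)

theorem isSimpleSystem_of_mem {x : (Fin 4 → Fin 24) × ℕ}
    (hx : x ∈ subgroupsB4 ++ subgroups2A2) : IsSimpleSystem x.1 x.2 :=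
  (List.mem_append.1 hx).elim (isSimpleSystem_B4 x) (isSimpleSystem_2A2 x)

theorem groupOf_bitSet_ne {x : (Fin 4 → Fin 24) × ℕ} (hx : x ∈ subgroupsB4 ++ subgroups2A2) :
    groupOf (bitSet x.2) ≠ weylF4 := by
  intro h
  obtain ⟨i, hi⟩ := exists_not_testBit x hx
  have h1 := congrArg mirrors h
  rw [weylF4_eq, mirrors_groupOf (isSimpleSystem_of_mem hx).stable, mirrors_groupOf stable_univ]
    at h1
  have h2 : i ∈ bitSet x.2 := h1 ▸ Set.mem_univ i
  exact absurd h2 (by simp [bitSet, hi])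

theorem groupOf_zero_one_two_three {S : Set (Fin 24)} (h0 : 0 ∈ S) (h1 : 1 ∈ S) (h2 : 2 ∈ S)
    (h3 : 3 ∈ S) : groupOf S = weylF4 := by
  rw [weylF4_eq]
  refine le_antisymm (groupOf_mono (Set.subset_univ S)) (groupOf_le fun i _ => ?_)
  have hS : ∀ j ∈ S, ∀ i, (∀ k < i, reflIn (root k) ∈ groupOf S) → image j i < i →
      reflIn (root i) ∈ groupOf S := by
    intro j hj i ih hi
    have h := reflIn_root_image j (image j i)
    rw [image_image] at h
    rw [h]
    exact mul_mem (mul_mem (reflIn_mem_groupOf hj) (ih _ hi)) (reflIn_mem_groupOf hj)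
  induction i using WellFoundedLT.induction with
  | ind i ih =>
    have ih' : ∀ k < i, reflIn (root k) ∈ groupOf S := fun k hk => ih k hk (Set.mem_univ k)
    rcases generate_all i with rfl | rfl | rfl | rfl | h | h | h | h
    · exact reflIn_mem_groupOf h0
    · exact reflIn_mem_groupOf h1
    · exact reflIn_mem_groupOf h2
    · exact reflIn_mem_groupOf h3
    · exact hS _ h0 i ih' h
    · exact hS _ h1 i ih' h
    · exact hS _ h2 i ih' h
    · exact hS _ h3 i ih' h

theorem exists_monotone_range_eq {T : Set (Fin 24)} (h0 : T.Nonempty) (h4 : T.ncard ≤ 4) :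
    ∃ f : Fin 4 → Fin 24, Monotone f ∧ Set.range f = T := by
  classical
  rw [Set.ncard_eq_toFinset_card'] at h4
  have hpos : 0 < T.toFinset.card := Finset.card_pos.2 (Set.toFinset_nonempty.2 h0)
  let e := T.toFinset.orderEmbOfFin rfl
  have he : Set.range e = T := by
    rw [Finset.range_orderEmbOfFin, Set.coe_toFinset]
  -- The elements are listed in increasing order, and the largest is repeated to fill four places.
  refine ⟨fun p => e ⟨min p (T.toFinset.card - 1), by omega⟩, fun p q hpq => ?_, ?_⟩
  · refine e.monotone ?_
    change min (p : ℕ) _ ≤ min (q : ℕ) _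
    have : (p : ℕ) ≤ q := hpq
    omega
  · refine Set.Subset.antisymm ?_ ?_
    · rintro _ ⟨p, rfl⟩
      exact he.subset ⟨_, rfl⟩
    · intro i hi
      rw [← he] at hi
      obtain ⟨q, rfl⟩ := hi
      refine ⟨⟨q, by omega⟩, congrArg e (Fin.ext ?_)⟩
      change min (q : ℕ) _ = q
      omega

/-- Each reflection subgroup other than the whole group lies in one of the listed groups. -/
theorem exists_le_groupOf_bitSet
    {H : Subgroup (EuclideanSpace ℝ (Fin 4) ≃ₗᵢ[ℝ] EuclideanSpace ℝ (Fin 4))}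
    (hH : IsReflectionSubgroup weylF4 H) (hne : H ≠ weylF4) :
    ∃ x ∈ subgroupsB4 ++ subgroups2A2, H ≤ groupOf (bitSet x.2) := by
  have hS := stable_mirrors H
  have hHT : groupOf (simples (mirrors H)) = H := (groupOf_simples _).trans (groupOf_mirrors hH)
  rcases (simples (mirrors H)).eq_empty_or_nonempty with h0 | h0
  · refine ⟨_, List.mem_cons_self, ?_⟩
    rw [← hHT, h0]
    exact groupOf_mono (Set.empty_subset _)
  · obtain ⟨f, hf, hr⟩ := exists_monotone_range_eq h0 (ncard_simples_le hS)
    have hang : ∀ p q, angle (f p) (f q) ≤ 4 := fun p q =>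
      angle_le_four_of_mem_simples hS (hr ▸ ⟨p, rfl⟩) (hr ▸ ⟨q, rfl⟩)
    rw [← hHT, ← hr] at hne ⊢
    rcases exists_maximal_testBit (f 0) (f 1) (hf (by decide)) (hang _ _) (f 2) (hf (by decide))
      (hang _ _) (hang _ _) (f 3) (hf (by decide)) (hang _ _) (hang _ _) (hang _ _) with
      ⟨x, hx, b0, b1, b2, b3⟩ | ⟨b0, b1, b2, b3⟩
    · refine ⟨x, hx, groupOf_mono ?_⟩
      rintro _ ⟨p, rfl⟩
      fin_cases p
      exacts [b0, b1, b2, b3]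
    · exact absurd (groupOf_zero_one_two_three (S := Set.range f) ⟨0, b0⟩ ⟨1, b1⟩ ⟨2, b2⟩ ⟨3, b3⟩) hne

theorem finite_of_le {H : Subgroup (EuclideanSpace ℝ (Fin 4) ≃ₗᵢ[ℝ] EuclideanSpace ℝ (Fin 4))}
    (h : H ≤ weylF4) : Finite H :=
  have := finite_weylF4
  Finite.of_injective _ (Subgroup.inclusion_injective h)

/-- A reflection subgroup with the same diagram as a group that contains it is equal to it. -/
theorem HasType.eq_of_le {B : Type*} {M : CoxeterMatrix B}
    {H K : Subgroup (EuclideanSpace ℝ (Fin 4) ≃ₗᵢ[ℝ] EuclideanSpace ℝ (Fin 4))}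
    (hH : HasType H M) (hK : HasType K M) (hle : H ≤ K) (hKG : K ≤ weylF4) : H = K := by
  have := finite_of_le hKG
  exact Subgroup.eq_of_le_of_card_ge hle (hH.card_eq hK).ge

theorem groupOf_le_weylF4 (S : Set (Fin 24)) : groupOf S ≤ weylF4 :=
  (isReflectionSubgroup_groupOf S).1

theorem mem_bitSet_of_groupOf_range_le {B : Type*} {t : B → Fin 24} {s : Fin 4 → Fin 24} {m : ℕ}
    (hm : IsSimpleSystem s m) (h : groupOf (Set.range t) ≤ groupOf (bitSet m)) (p : B) :
    m.testBit (t p) = true := by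
  have h1 : t p ∈ mirrors (groupOf (bitSet m)) := h (reflIn_mem_groupOf ⟨p, rfl⟩)
  rwa [mirrors_groupOf hm.stable] at h1

theorem not_le_of_hasType_B4 {x : (Fin 4 → Fin 24) × ℕ} (hx : x ∈ subgroups2A2)
    {H : Subgroup (EuclideanSpace ℝ (Fin 4) ≃ₗᵢ[ℝ] EuclideanSpace ℝ (Fin 4))}
    (hH : HasType H (CoxeterMatrix.B 4)) : ¬ H ≤ groupOf (bitSet x.2) := by
  intro hle
  obtain ⟨t, rfl, ht⟩ := hH.exists_roots (hle.trans (groupOf_le_weylF4 _))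
  have hb := mem_bitSet_of_groupOf_range_le (isSimpleSystem_2A2 x hx) hle
  -- In `CoxeterMatrix.B 4` the label `4` joins the last two nodes.
  exact no_B2_in_2A2 x hx (t 2) (t 3) (hb 2) (hb 3) (angle_of_cos_four (by rfl) (ht 2 3))

theorem not_le_of_hasType_2A2 {x : (Fin 4 → Fin 24) × ℕ} (hx : x ∈ subgroupsB4)
    {H : Subgroup (EuclideanSpace ℝ (Fin 4) ≃ₗᵢ[ℝ] EuclideanSpace ℝ (Fin 4))}
    (hH : HasType H (disjointUnion (CoxeterMatrix.A 2) (CoxeterMatrix.A 2))) :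
    ¬ H ≤ groupOf (bitSet x.2) := by
  intro hle
  obtain ⟨t, rfl, ht⟩ := hH.exists_roots (hle.trans (groupOf_le_weylF4 _))
  have hb := mem_bitSet_of_groupOf_range_le (isSimpleSystem_B4 x hx) hle
  exact no_2A2_in_B4 x hx (t (.inl 0)) (t (.inl 1)) (hb _) (hb _)
    (angle_of_cos_three (by rfl) (ht _ _)) (t (.inr 0)) (hb _)
    (angle_of_cos_two (by rfl) (ht _ _)) (angle_of_cos_two (by rfl) (ht _ _)) (t (.inr 1)) (hb _)
    (angle_of_cos_two (by rfl) (ht _ _)) (angle_of_cos_two (by rfl) (ht _ _))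
    (angle_of_cos_three (by rfl) (ht _ _))

/-- `L` holds the listed groups of type `M`, `L'` the others. A proper reflection subgroup
containing `H` lies in a listed group; that group cannot come from `L'`, and if it comes from `L` it
equals `H` by comparison of orders. -/
theorem isMaximal_of_forall {B : Type*} {M : CoxeterMatrix B}
    {L L' : List ((Fin 4 → Fin 24) × ℕ)}
    (hL : ∀ x ∈ L, HasType (groupOf (bitSet x.2)) M)
    (hL' : ∀ x ∈ L', ∀ {H}, HasType H M → ¬ H ≤ groupOf (bitSet x.2))
    (hne : ∃ x, x ∈ L) (hmem : ∀ x, x ∈ subgroupsB4 ++ subgroups2A2 ↔ x ∈ L ∨ x ∈ L')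
    {H : Subgroup (EuclideanSpace ℝ (Fin 4) ≃ₗᵢ[ℝ] EuclideanSpace ℝ (Fin 4))}
    (hH : IsReflectionSubgroup weylF4 H) (hM : HasType H M) :
    IsMaximalReflectionSubgroup weylF4 H := by
  have hcover : ∀ K, IsReflectionSubgroup weylF4 K → K ≠ weylF4 → H ≤ K → K ≤ H := by
    intro K hK hKne hHK
    obtain ⟨x, hx, hKx⟩ := exists_le_groupOf_bitSet hK hKne
    rcases (hmem x).1 hx with hx | hx
    · rw [hM.eq_of_le (hL x hx) (hHK.trans hKx) (groupOf_le_weylF4 _)]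
      exact hKx
    · exact absurd (hHK.trans hKx) (hL' x hx hM)
  refine ⟨⟨hH, ?_⟩, fun K hK hHK => hcover K hK.1 hK.2 hHK⟩
  -- If the whole group had type `M`, a listed group of type `M` would equal it, although it misses
  -- a mirror.
  rintro rfl
  obtain ⟨x, hx⟩ := hne
  exact groupOf_bitSet_ne ((hmem x).2 (Or.inl hx))
    ((hL x hx).eq_of_le hM (groupOf_le_weylF4 _) le_rfl)

theorem isMaximalReflectionSubgroup_iff
    (H : Subgroup (EuclideanSpace ℝ (Fin 4) ≃ₗᵢ[ℝ] EuclideanSpace ℝ (Fin 4))) :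
    IsMaximalReflectionSubgroup weylF4 H ↔ IsReflectionSubgroup weylF4 H ∧
      (HasType H (CoxeterMatrix.B 4) ∨
        HasType H (disjointUnion (CoxeterMatrix.A 2) (CoxeterMatrix.A 2))) := by
  constructor
  · rintro ⟨⟨hH, hne⟩, hmax⟩
    refine ⟨hH, ?_⟩
    obtain ⟨x, hx, hle⟩ := exists_le_groupOf_bitSet hH hne
    have heq : H = groupOf (bitSet x.2) := le_antisymm hle
      (hmax ⟨isReflectionSubgroup_groupOf _, groupOf_bitSet_ne hx⟩ hle)
    rw [heq]
    exact (List.mem_append.1 hx).imp hasType_subgroupsB4 hasType_subgroups2A2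
  · rintro ⟨hH, h | h⟩
    · exact isMaximal_of_forall (fun x => hasType_subgroupsB4) (fun x hx _ => not_le_of_hasType_B4 hx)
        ⟨_, List.mem_cons_self⟩ (fun x => List.mem_append) hH h
    · exact isMaximal_of_forall (fun x => hasType_subgroups2A2)
        (fun x hx _ => not_le_of_hasType_2A2 hx) ⟨_, List.mem_cons_self⟩
        (fun x => List.mem_append.trans or_comm) hH h

/-! ### Rank 4 subgroups and closed root subsystems. -/

/-- The Coxeter matrix of an injective family of roots. -/
def coxeterMatrixOf (t : Fin 4 → Fin 24) (ht : ∀ p q, angle (t p) (t q) = 1 → p = q) :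
    CoxeterMatrix (Fin 4) where
  M := Matrix.of fun p q => angle (t p) (t q)
  isSymm := by
    ext p q
    exact angle_comm _ _
  diagonal p := angle_self _
  off_diagonal p q hpq h := hpq (ht p q h)

theorem SameAngles.angle_eq {a b c d : Fin 24} {t : Fin 4 → Fin 24} (h : SameAngles a b c d t)
    (p q : Fin 4) : angle (![a, b, c, d] p) (![a, b, c, d] q) = angle (t p) (t q) := by
  obtain ⟨h1, h2, h3, h4, h5, h6⟩ := h
  wlog hpq : p ≤ q generalizing p q
  · rw [angle_comm, angle_comm (t p)]
    exact this q p (le_of_not_ge hpq)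
  rcases hpq.eq_or_lt with rfl | hlt
  · rw [angle_self, angle_self]
  · fin_cases p <;> fin_cases q <;>
      first | exact absurd hlt (by decide) | assumption

/-- A reflection subgroup of rank `4` has simple roots with the same angles as the simple roots of
type `2B₂`, or as the simple roots of one of the listed closed subsystems. -/
theorem exists_range_eq
    {H : Subgroup (EuclideanSpace ℝ (Fin 4) ≃ₗᵢ[ℝ] EuclideanSpace ℝ (Fin 4))}
    (hH : IsReflectionSubgroup weylF4 H) (hr : rank H = 4) :
    ∃ s : Fin 4 → Fin 24, groupOf (Set.range s) = H ∧ (∀ p q, angle (s p) (s q) ≤ 4) ∧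
      ((∀ p q, angle (s p) (s q) = angle (roots2B2 p) (roots2B2 q)) ∨
        ∃ x ∈ closedSubsystems, ∀ p q, angle (s p) (s q) = angle (x.1 p) (x.1 q)) := by
  have hS := stable_mirrors H
  have hcard : (simples (mirrors H)).ncard = 4 := by
    rw [ncard_simples hS, groupOf_mirrors hH, hr]
  obtain ⟨f, hf, hrange⟩ := exists_monotone_range_eq
    (Set.nonempty_of_ncard_ne_zero (by rw [hcard]; norm_num)) hcard.le
  -- Four indices have four values, so the list has no repetition.
  have hinj : Function.Injective f := by
    rw [← Set.injOn_univ, ← Set.ncard_image_iff, Set.image_univ, hrange, hcard, Set.ncard_univ]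
    simp
  have hmono := hf.strictMono_of_injective hinj
  have hang : ∀ p q, angle (f p) (f q) ≤ 4 := fun p q =>
    angle_le_four_of_mem_simples hS (hrange ▸ ⟨p, rfl⟩) (hrange ▸ ⟨q, rfl⟩)
  obtain ⟨a, ha, b, hb, hba, c, hc, hca, hcb, d, hd, hda, hdb, hdc, h⟩ :=
    hasListedAngles (f 0) (f 1) (hmono (by decide)) (hang _ _) (f 2) (hmono (by decide))
      (hang _ _) (hang _ _) (f 3) (hmono (by decide)) (hang _ _) (hang _ _) (hang _ _)
  have hmem : ∀ i ∈ [f 0, f 1, f 2, f 3], i ∈ simples (mirrors H) := by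
    intro i hi
    rw [← hrange]
    simp only [List.mem_cons, List.not_mem_nil, or_false] at hi
    rcases hi with rfl | rfl | rfl | rfl <;> exact ⟨_, rfl⟩
  have hsub : Set.range ![a, b, c, d] ⊆ simples (mirrors H) := by
    rintro _ ⟨p, rfl⟩
    fin_cases p
    exacts [hmem a ha, hmem b hb, hmem c hc, hmem d hd]
  have hsinj : Function.Injective ![a, b, c, d] := by
    intro p q hpq
    fin_cases p <;> fin_cases q <;> simp_all
  have heq : Set.range ![a, b, c, d] = simples (mirrors H) := by
    refine Set.eq_of_subset_of_ncard_le hsub ?_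
    rw [hcard, ← Set.image_univ, Set.ncard_image_of_injective _ hsinj, Set.ncard_univ]
    simp
  refine ⟨![a, b, c, d], ?_, fun p q => ?_, ?_⟩
  · rw [heq, groupOf_simples, groupOf_mirrors hH]
  · exact angle_le_four_of_mem_simples hS (hsub ⟨p, rfl⟩) (hsub ⟨q, rfl⟩)
  · exact h.imp (fun h => h.angle_eq) fun ⟨x, hx, h⟩ => ⟨x, hx, h.angle_eq⟩

/-- The roots whose mirrors are in `S`. -/
def rootsOf (S : Set (Fin 24)) : Set (EuclideanSpace ℝ (Fin 4)) :=
  {v | ∃ i ∈ S, v = root i ∨ v = -root i}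

theorem weylGroup_rootsOf (S : Set (Fin 24)) : weylGroup (rootsOf S) = groupOf S :=
  weylGroup_eq (fun _ hv => hv) fun i hi => ⟨i, hi, Or.inl rfl⟩

theorem rootZ_eq_of_root_eq {i j k : Fin 24} {a b c : ℤ}
    (h : (a : ℝ) • root i + (b : ℝ) • root j = (c : ℝ) • root k) (l : Fin 4) :
    a * rootZ i l + b * rootZ j l = c * rootZ k l := by
  have h1 := congrArg (fun v : EuclideanSpace ℝ (Fin 4) => v l) h
  simp only [PiLp.add_apply, PiLp.smul_apply, root_apply, smul_eq_mul] at h1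
  have h2 : (a : ℝ) * rootZ i l + b * rootZ j l = c * rootZ k l := by linarith
  exact_mod_cast h2

theorem isClosedRootSubsystem_rootsOf {x : (Fin 4 → Fin 24) × ℕ} (hx : x ∈ closedSubsystems) :
    IsClosedRootSubsystem rootsF4 (rootsOf (bitSet x.2)) where
  subset := by
    rintro _ ⟨i, -, rfl | rfl⟩
    · exact root_mem_rootsF4 i
    · exact neg_mem_rootsF4 (root_mem_rootsF4 i)
  refl_mem := by
    have key : ∀ i ∈ bitSet x.2, ∀ j ∈ bitSet x.2,
        reflIn (root i) (root j) ∈ rootsOf (bitSet x.2) ∧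
          -reflIn (root i) (root j) ∈ rootsOf (bitSet x.2) := by
      intro i hi j hj
      have hk := (isSimpleSystem_closedSubsystems x hx).stable i hi j hj
      rw [reflIn_root]
      rcases cast_imageSign i j with h | h <;> rw [h]
      · exact ⟨⟨_, hk, Or.inl (one_smul _ _)⟩, ⟨_, hk, Or.inr (by rw [one_smul])⟩⟩
      · exact ⟨⟨_, hk, Or.inr (neg_one_smul _ _)⟩, ⟨_, hk, Or.inl (by rw [neg_one_smul, neg_neg])⟩⟩
    rintro _ ⟨i, hi, rfl | rfl⟩ _ ⟨j, hj, rfl | rfl⟩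
    · exact (key i hi j hj).1
    · rw [map_neg]
      exact (key i hi j hj).2
    · rw [reflIn_neg]
      exact (key i hi j hj).1
    · rw [reflIn_neg, map_neg]
      exact (key i hi j hj).2
  add_mem := by
    intro v hv w hw hvw
    obtain ⟨k, hk⟩ := exists_eq_root hvw
    refine ⟨k, ?_, hk⟩
    by_contra hkx
    have hkx' : x.2.testBit k = false := by simpa [bitSet] using hkx
    have key : ∀ i ∈ bitSet x.2, ∀ j ∈ bitSet x.2, ∀ a b c : ℤ, (a = 1 ∨ a = -1) →
        (b = 1 ∨ b = -1) → (c = 1 ∨ c = -1) →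
        (a : ℝ) • root i + (b : ℝ) • root j ≠ (c : ℝ) • root k := by
      intro i hi j hj a b c ha hb hc h
      have h1 := rootZ_eq_of_root_eq h
      obtain ⟨n1, n2, n3, n4⟩ := closedSubsystems_add x hx k hkx' i hi j hj
      rcases ha with rfl | rfl <;> rcases hb with rfl | rfl <;> rcases hc with rfl | rfl
      · exact n1 fun l => by linarith [h1 l]
      · exact n2 fun l => by linarith [h1 l]
      · exact n3 fun l => by linarith [h1 l]
      · exact n4 fun l => by linarith [h1 l]
      · exact n4 fun l => by linarith [h1 l]
      · exact n3 fun l => by linarith [h1 l]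
      · exact n2 fun l => by linarith [h1 l]
      · exact n1 fun l => by linarith [h1 l]
    have hsign : ∀ u : EuclideanSpace ℝ (Fin 4), ∀ i, u = root i ∨ u = -root i →
        ∃ a : ℤ, (a = 1 ∨ a = -1) ∧ u = (a : ℝ) • root i := by
      rintro u i (rfl | rfl)
      · exact ⟨1, Or.inl rfl, by simp⟩
      · exact ⟨-1, Or.inr rfl, by simp⟩
    obtain ⟨i, hi, hvi⟩ := hv
    obtain ⟨j, hj, hwj⟩ := hw
    obtain ⟨a, ha, rfl⟩ := hsign v i hvi
    obtain ⟨b, hb, rfl⟩ := hsign w j hwj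
    obtain ⟨c, hc, h⟩ := hsign _ k hk
    exact key i hi j hj a b c ha hb hc h

theorem exists_closed_of_not_hasType
    {H : Subgroup (EuclideanSpace ℝ (Fin 4) ≃ₗᵢ[ℝ] EuclideanSpace ℝ (Fin 4))}
    (hH : IsReflectionSubgroup weylF4 H) (hr : rank H = 4)
    (h : ¬ HasType H (disjointUnion (CoxeterMatrix.B 2) (CoxeterMatrix.B 2))) :
    ∃ Δ₁, IsClosedRootSubsystem rootsF4 Δ₁ ∧ SameType H (weylGroup Δ₁) := by
  obtain ⟨s, rfl, h4, hs | ⟨x, hx, hs⟩⟩ := exists_range_eq hH hr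
  · refine absurd ?_ h
    rw [← EquivLike.range_comp s (finSumFinEquiv (m := 2) (n := 2))]
    refine hasType_groupOf (fun p q => ?_) fun p q => h4 _ _
    exact (angle_roots2B2.1 p q).trans (hs _ _).symm
  · have hx' := isSimpleSystem_closedSubsystems x hx
    refine ⟨_, isClosedRootSubsystem_rootsOf hx, 4, coxeterMatrixOf x.1 hx'.2.1, ?_, ?_⟩
    · exact hasType_groupOf (fun p q => (hs p q).symm) h4
    · rw [weylGroup_rootsOf, ← hx'.groupOf_eq]
      exact hasType_groupOf (fun p q => rfl) hx'.1

/-- A root subsystem contains the negatives of its roots, so its positive members form a stable set,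
and the Weyl group acquires no further mirrors: it determines the subsystem. -/
theorem mirrors_weylGroup {Δ : Set (EuclideanSpace ℝ (Fin 4))}
    (hΔ : IsClosedRootSubsystem rootsF4 Δ) : mirrors (weylGroup Δ) = {i | root i ∈ Δ} := by
  have hneg : ∀ v ∈ Δ, -v ∈ Δ := fun v hv => reflIn_self v ▸ hΔ.refl_mem v hv v hv
  have hstable : Stable {i | root i ∈ Δ} := by
    intro i hi j hj
    have h := hΔ.refl_mem _ hi _ hj
    rw [reflIn_root] at h
    change root (image i j) ∈ Δ
    rcases cast_imageSign i j with h1 | h1 <;> rw [h1] at h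
    · rwa [one_smul] at h
    · rw [neg_one_smul] at h
      simpa using hneg _ h
  rw [weylGroup_eq (Δ := Δ) (S := {i | root i ∈ Δ}) ?_ fun i hi => hi, mirrors_groupOf hstable]
  intro v hv
  obtain ⟨i, h⟩ := exists_eq_root (hΔ.subset hv)
  refine ⟨i, ?_, h⟩
  rcases h with rfl | rfl
  · exact hv
  · simpa using hneg _ hv

/-- Two long roots at angle $\pi/4$ or $3\pi/4$ would have an integer inner product with square
$32$. -/
theorem gramZ_of_angle_four {i j : Fin 24} (h : angle i j = 4 ∨ angle i j = 6) :
    gramZ i i = 4 ∨ gramZ j j = 4 := by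
  rcases gramZ_self i with hi | hi
  · exact Or.inl hi
  rcases gramZ_self j with hj | hj
  · exact Or.inr hj
  have h2 : gramZ i j ^ 2 = 32 := by
    rcases angle_spec i j with h1 | h1 | h1 | h1 | h1 | h1 <;> try omega
    · nlinarith [h1.2.2]
    · nlinarith [h1.2.2]
  have h3 : gramZ i j ≤ 5 := by nlinarith
  have h4 : -5 ≤ gramZ i j := by nlinarith
  interval_cases gramZ i j <;> omega

/-- The Weyl group of a closed root subsystem of `F₄` is not of type `2B₂`. -/
theorem IsClosedRootSubsystem.not_hasType {Δ : Set (EuclideanSpace ℝ (Fin 4))}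
    (hΔ : IsClosedRootSubsystem rootsF4 Δ) :
    ¬ HasType (weylGroup Δ) (disjointUnion (CoxeterMatrix.B 2) (CoxeterMatrix.B 2)) := by
  intro hT
  have hle : weylGroup Δ ≤ weylF4 := by
    rw [weylF4]
    exact Subgroup.closure_mono (Set.image_mono hΔ.subset)
  obtain ⟨t, hK, ht⟩ := hT.exists_roots hle
  have hm := mirrors_weylGroup hΔ
  have htΔ : ∀ p, root (t p) ∈ Δ := by
    intro p
    have : t p ∈ mirrors (weylGroup Δ) := by
      rw [← hK]
      exact reflIn_mem_groupOf ⟨p, rfl⟩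
    rwa [hm] at this
  have horth : ∀ p q, angle (t (.inl p)) (t (.inr q)) = 2 := fun p q =>
    angle_of_cos_two (by rfl) (ht _ _)
  have hinner : ∀ i j, angle i j = 2 → inner ℝ (root i) (root j) = 0 := by
    intro i j h
    have : gramZ i j = 0 := by
      rcases angle_spec i j with h1 | h1 | h1 | h1 | h1 | h1 <;> omega
    rw [inner_root, this]
    simp
  have hpair : ∀ (e : Fin 2 → Fin 2 ⊕ Fin 2), (angle (t (e 0)) (t (e 1)) = 4 ∨
      angle (t (e 0)) (t (e 1)) = 6) → ∃ p, gramZ (t (e p)) (t (e p)) = 4 := fun e he =>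
    (gramZ_of_angle_four he).elim (fun h => ⟨0, h⟩) fun h => ⟨1, h⟩
  obtain ⟨p, hp⟩ := hpair Sum.inl (angle_of_cos_four (by rfl) (ht _ _))
  obtain ⟨q, hq⟩ := hpair Sum.inr (angle_of_cos_four (by rfl) (ht _ _))
  obtain ⟨k, hk⟩ := exists_sum_of_short _ _ hp hq (horth p q)
  have hk' : root k = root (t (.inl p)) + root (t (.inr q)) := by
    ext c
    rw [PiLp.add_apply, root_apply, root_apply, root_apply, hk]
    push_cast
    ring
  have hkΔ : root k ∈ Δ := by
    have h := hΔ.add_mem _ (htΔ (.inl p)) _ (htΔ (.inr q))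
    rw [← hk'] at h
    exact h (root_mem_rootsF4 k)
  have hkK : reflIn (root k) ∈ groupOf (Set.range t) := by
    rw [hK]
    exact Subgroup.subset_closure ⟨_, hkΔ, rfl⟩
  -- The orthogonal complement of the second factor is invariant: reflections of the first factor
  -- fix the roots of the second, and those of the second fix the complement pointwise.
  have hpres : ∀ g ∈ groupOf (Set.range t), ∀ v : EuclideanSpace ℝ (Fin 4),
      (∀ q, inner ℝ (root (t (.inr q))) v = 0) → ∀ q, inner ℝ (root (t (.inr q))) (g v) = 0 := by
    have hgen : ∀ r, ∀ v : EuclideanSpace ℝ (Fin 4),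
        (∀ q, inner ℝ (root (t (.inr q))) v = 0) →
        ∀ q, inner ℝ (root (t (.inr q))) (reflIn (root (t r)) v) = 0 := by
      rintro (r | r) v hv q
      · rw [← inner_reflIn_left, reflIn_eq_self_of_inner_eq_zero (hinner _ _ (horth r q))]
        exact hv q
      · rw [reflIn_eq_self_of_inner_eq_zero (hv r)]
        exact hv q
    intro g hg
    induction hg using Subgroup.closure_induction'' with
    | mem g hg =>
      obtain ⟨_, ⟨r, rfl⟩, rfl⟩ := hg
      exact hgen r
    | inv_mem g hg =>
      obtain ⟨_, ⟨r, rfl⟩, rfl⟩ := hg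
      dsimp only
      rw [reflIn_inv]
      exact hgen r
    | one => exact fun v hv => hv
    | mul g h _ _ h1 h2 => exact fun v hv => h1 _ (h2 v hv)
  have h0 := hinner _ _ (horth p q)
  have h1 := hpres _ hkK (root (t (.inl p)))
    (fun q => by rw [real_inner_comm]; exact hinner _ _ (horth p q)) q
  have hpp : inner ℝ (root (t (.inl p))) (root (t (.inl p))) = (1 : ℝ) := by
    rw [inner_root, hp]
    norm_num
  have hqq : inner ℝ (root (t (.inr q))) (root (t (.inr q))) = (1 : ℝ) := by
    rw [inner_root, hq]
    norm_num
  have h0' : inner ℝ (root (t (.inr q))) (root (t (.inl p))) = (0 : ℝ) := by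
    rw [real_inner_comm]
    exact h0
  -- For orthogonal unit vectors $a,b$, the reflection in $a+b$ sends $a$ to $-b$. Thus a root of
  -- the first factor leaves the complement of the second.
  rw [reflIn_apply, ← real_inner_self_eq_norm_sq, hk'] at h1
  simp only [inner_sub_right, real_inner_smul_right, inner_add_left, inner_add_right, h0, h0', hpp,
    hqq] at h1
  norm_num at h1

end

end ReflectionSubgroup

theorem lemma7 :
    -- classification of the maximal reflection subgroups of `F₄`
    (∀ H : Subgroup (EuclideanSpace ℝ (Fin 4) ≃ₗᵢ[ℝ] EuclideanSpace ℝ (Fin 4)),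
      ReflectionSubgroup.IsMaximalReflectionSubgroup ReflectionSubgroup.weylF4 H ↔
        ReflectionSubgroup.IsReflectionSubgroup ReflectionSubgroup.weylF4 H ∧
          (ReflectionSubgroup.HasType H (CoxeterMatrix.B 4) ∨
            ReflectionSubgroup.HasType H
              (ReflectionSubgroup.disjointUnion (CoxeterMatrix.A 2) (CoxeterMatrix.A 2)))) ∧
    -- both types occur
    (∃ H : Subgroup (EuclideanSpace ℝ (Fin 4) ≃ₗᵢ[ℝ] EuclideanSpace ℝ (Fin 4)),
      ReflectionSubgroup.IsReflectionSubgroup ReflectionSubgroup.weylF4 H ∧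
        ReflectionSubgroup.HasType H (CoxeterMatrix.B 4)) ∧
    (∃ H : Subgroup (EuclideanSpace ℝ (Fin 4) ≃ₗᵢ[ℝ] EuclideanSpace ℝ (Fin 4)),
      ReflectionSubgroup.IsReflectionSubgroup ReflectionSubgroup.weylF4 H ∧
        ReflectionSubgroup.HasType H
          (ReflectionSubgroup.disjointUnion (CoxeterMatrix.A 2) (CoxeterMatrix.A 2))) ∧
    -- `2B₂` occurs as the type of a maximal rank reflection subgroup of `F₄`
    (∃ H : Subgroup (EuclideanSpace ℝ (Fin 4) ≃ₗᵢ[ℝ] EuclideanSpace ℝ (Fin 4)),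
      ReflectionSubgroup.IsReflectionSubgroup ReflectionSubgroup.weylF4 H ∧
        ReflectionSubgroup.rank H = 4 ∧
        ReflectionSubgroup.HasType H
          (ReflectionSubgroup.disjointUnion (CoxeterMatrix.B 2) (CoxeterMatrix.B 2))) ∧
    -- and it is the only such type that is not the type of a closed root subsystem
    (∀ H : Subgroup (EuclideanSpace ℝ (Fin 4) ≃ₗᵢ[ℝ] EuclideanSpace ℝ (Fin 4)),
      ReflectionSubgroup.IsReflectionSubgroup ReflectionSubgroup.weylF4 H →
      ReflectionSubgroup.rank H = 4 →
        ((¬ ∃ Δ₁ : Set (EuclideanSpace ℝ (Fin 4)),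
            ReflectionSubgroup.IsClosedRootSubsystem ReflectionSubgroup.rootsF4 Δ₁ ∧
              ReflectionSubgroup.SameType H (ReflectionSubgroup.weylGroup Δ₁)) ↔
          ReflectionSubgroup.HasType H
            (ReflectionSubgroup.disjointUnion (CoxeterMatrix.B 2) (CoxeterMatrix.B 2)))) := by
  open ReflectionSubgroup in
  refine ⟨isMaximalReflectionSubgroup_iff,
    ⟨_, isReflectionSubgroup_groupOf _, hasType_subgroupsB4 List.mem_cons_self⟩,
    ⟨_, isReflectionSubgroup_groupOf _, hasType_subgroups2A2 List.mem_cons_self⟩,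
    ⟨_, isReflectionSubgroup_groupOf _,
      rank_groupOf_range angle_roots2B2.2.1 angle_roots2B2.2.2, hasType_roots2B2⟩,
    fun H hH hr => ⟨fun h => ?_, ?_⟩⟩
  · by_contra hc
    exact h (exists_closed_of_not_hasType hH hr hc)
  · rintro h ⟨Δ₁, hΔ, hs⟩
    exact hΔ.not_hasType (h.of_sameType hs)
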